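/- Let $\mathcal F$ be an ordinary differential field of characteristic $0$ with derivation $\delta$, let $\mathcal E$ be a differential field extension of $\mathcal F$, and let $u\in\mathcal E$ be differentially transcendental over $\mathcal F$ (that is, $u,u',u'',\dots$ are algebraically independent over $\mathcal F$). Let $A\in\mathcal F\{x,y\}$ be an irreducible differential polynomial, with saturation ideal $\mathrm{sat}(A)=[A]:H_A^\infty$, where $[A]$ is the differential ideal generated by $A$ and $H_A$ is the product of the initial and the separant of $A$ under a given ranking of the derivatives of $x,y$; let $(\mathcal C,A)$ be the differential curve $\mathcal C=\mathbb V(\mathrm{sat}(A))$. Let $P_1,Q_1,P_2,Q_2\in\mathcal F\{u\}$ have total degree at most $1$ in $u,u',u'',\dots$, with $Q_i\neq0$ and $\gcd(P_i,Q_i)=1$ for $i=1,2$. Suppose that $\mathcal P(u)=\big(\tfrac{P_1(u)}{Q_1(u)},\tfrac{P_2(u)}{Q_2(u)}\big)$ is a differential rational parametrization of $(\mathcal C,A)$, that is, a generic point: $\{f\in\mathcal F\{x,y\}: f(\mathcal P(u))=0\}=\mathrm{sat}(A)$. Suppose that $\mathcal P(u)$ is proper, that is, $\mathcal F\langle \tfrac{P_1(u)}{Q_1(u)},\tfrac{P_2(u)}{Q_2(u)}\rangle=\mathcal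 F\langle u\rangle$, where $\mathcal F\langle S\rangle$ is the differential field generated by $S$ over $\mathcal F$. For $i=1,2$ suppose that $m_i:=\max\{\mathrm{ord}\,P_i,\mathrm{ord}\,Q_i\}\ge0$, where the order of a differential polynomial is the largest $k$ such that a $k$-th derivative of an indeterminate appears in it, and is $-\infty$ for constants. For linear differential polynomials $f_1,f_2$ in $u$ of orders $n_1,n_2$ over a differential domain, let $\delta\text{-}\mathrm{Res}(f_1,f_2)$ be the determinant of the square matrix of size $n_1+n_2+2$ whose rows are the coefficient vectors of $f_1^{(n_2)},\dots,f_1',f_1,f_2^{(n_1)},\dots,f_2',f_2$ with respect to $u^{(n_1+n_2)},\dots,u',u,1$. Then $A$ is the main irreducible factor of $$R=\delta\text{-}\mathrm{Res}\big(xQ_1(u)-P_1(u),\;yQ_2(u)-P_2(u)\big)\in\mathcal F\{x,y\},$$ that is, $A$ is irreducible and divides $R$, and if $R=AB$ then $\mathrm{ord}(B)<\mathrm{ord}(R)$. In particular, $\deg_{x^{(m_2)}}A=1$ and $\deg_{y^{(m_1)}}A=1$. -/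

import Mathlib

open MvPolynomial

noncomputable section

namespace DiffAlg

/-- The ring `R{y_i : i ∈ σ}` of differential polynomials as a polynomial ring:
the variable `(i, k)` is the derivative `y_i^{(k)}`. -/
abbrev DiffPoly (σ : Type*) (R : Type*) [CommRing R] := MvPolynomial (σ × ℕ) R

/-- The `k`-th derivative `a^{(k)}` in a differential ring. -/
def iterDeriv {R : Type*} [CommRing R] [Differential R] (k : ℕ) (a : R) : R :=
  (Differential.deriv : Derivation ℤ R R)^[k] a

section Derivation

variable {σ R : Type*} [CommRing R] [Differential R]

/-- Apply the derivation of `R` to the coefficients of a polynomial. -/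
def coeffDeriv {τ : Type*} (f : MvPolynomial τ R) : MvPolynomial τ R :=
  ∑ m ∈ f.support, monomial m (Differential.deriv (coeff m f))

lemma coeff_coeffDeriv {τ : Type*} (f : MvPolynomial τ R) (m : τ →₀ ℕ) :
    coeff m (coeffDeriv f) = Differential.deriv (coeff m f) := by
  classical
  unfold coeffDeriv
  rw [coeff_sum]
  simp only [coeff_monomial, Finset.sum_ite_eq', mem_support_iff]
  split_ifs with h
  · rfl
  · rw [not_not] at h
    rw [h, map_zero]

lemma coeffDeriv_add {τ : Type*} (f g : MvPolynomial τ R) :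
    coeffDeriv (f + g) = coeffDeriv f + coeffDeriv g := by
  ext m
  simp [coeff_coeffDeriv]

lemma coeffDeriv_mul {τ : Type*} (f g : MvPolynomial τ R) :
    coeffDeriv (f * g) = f * coeffDeriv g + g * coeffDeriv f := by
  classical
  ext m
  rw [mul_comm g]
  simp only [coeff_coeffDeriv, coeff_add, coeff_mul, map_sum, Derivation.leibniz, smul_eq_mul,
    ← Finset.sum_add_distrib]
  refine Finset.sum_congr rfl fun p _ => ?_
  ring

/-- The derivation of `R{y_i : i ∈ σ}`: it extends that of `R` and maps `y_i^{(k)}` to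
`y_i^{(k+1)}`. -/
instance : Differential (DiffPoly σ R) where
  deriv := Derivation.mk'
    (AddMonoidHom.toIntLinearMap
      (AddMonoidHom.mk' (fun f : DiffPoly σ R =>
          coeffDeriv f + mkDerivation R (fun v : σ × ℕ => (X (v.1, v.2 + 1) : DiffPoly σ R)) f)
        (fun f g => by rw [coeffDeriv_add, map_add]; ring)))
    (fun f g => by
      simp only [AddMonoidHom.coe_toIntLinearMap, AddMonoidHom.mk'_apply, coeffDeriv_mul,
        Derivation.leibniz, smul_eq_mul]
      ring)

lemma deriv_def (f : DiffPoly σ R) :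
    Differential.deriv f = coeffDeriv f +
      mkDerivation R (fun v : σ × ℕ => (X (v.1, v.2 + 1) : DiffPoly σ R)) f := rfl

lemma deriv_X (i : σ) (k : ℕ) :
    Differential.deriv (X (i, k) : DiffPoly σ R) = X (i, k + 1) := by
  classical
  have h : coeffDeriv (X (i, k) : DiffPoly σ R) = 0 := by
    ext m
    rw [coeff_coeffDeriv, coeff_X]
    split_ifs <;> simp
  rw [deriv_def, h, mkDerivation_X, zero_add]

lemma deriv_C (a : R) :
    Differential.deriv (C a : DiffPoly σ R) = C (Differential.deriv a) := by
  classical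
  have h : coeffDeriv (C a : DiffPoly σ R) = C (Differential.deriv a) := by
    ext m
    rw [coeff_coeffDeriv, coeff_C, coeff_C]
    split_ifs <;> simp
  rw [deriv_def, h, derivation_C, add_zero]

end Derivation

section Order

variable {σ R : Type*} [CommRing R]

/-- The order of a differential polynomial: the largest `k` such that some `y_i^{(k)}` appears in
it, and `⊥` (that is, `-∞`) if it is a constant. -/
def ord (f : DiffPoly σ R) : WithBot ℕ := f.vars.sup fun v => (v.2 : WithBot ℕ)

end Order

section Extension

variable (F : Type*) {E : Type*} [Field F] [Field E] [Differential E] [Algebra F E]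

/-- `u` is differentially transcendental over `F`. -/
def DiffTranscendental (u : E) : Prop :=
  AlgebraicIndependent F fun k : ℕ => iterDeriv k u

/-- `F⟨S⟩`, the field generated over `F` by all derivatives of the elements of `S`. -/
def diffAdjoin (S : Set E) : IntermediateField F E :=
  IntermediateField.adjoin F {a | ∃ s ∈ S, ∃ k : ℕ, a = iterDeriv k s}

variable {F} {σ : Type*}

/-- The value `f(η)` of a differential polynomial at a point with coordinates in `E`. -/
def diffEval (η : σ → E) : DiffPoly σ F →ₐ[F] E :=
  aeval fun v : σ × ℕ => iterDeriv v.2 (η v.1)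

/-- `𝕀(η)`, the ideal of the differential polynomials over `F` that vanish at `η`. -/
def vanishingIdeal (η : σ → E) : Ideal (DiffPoly σ F) :=
  RingHom.ker (diffEval η : DiffPoly σ F →ₐ[F] E)

/-- `η` is a generic point of the differential ideal `S` (and of the variety `𝕍(S)`). -/
def IsGenericPoint (η : σ → E) (S : Set (DiffPoly σ F)) : Prop :=
  ((vanishingIdeal η : Ideal (DiffPoly σ F)) : Set (DiffPoly σ F)) = S

end Extension

/-- A ranking: a total order on the derivatives `y_i^{(k)}`, compatible with the derivation. -/
structure Ranking (σ : Type*) where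
  lt : σ × ℕ → σ × ℕ → Prop
  isStrictTotalOrder : IsStrictTotalOrder (σ × ℕ) lt
  lt_deriv : ∀ v : σ × ℕ, lt v (v.1, v.2 + 1)
  deriv_lt_deriv : ∀ v w : σ × ℕ, lt v w → lt (v.1, v.2 + 1) (w.1, w.2 + 1)

section Saturation

variable {σ R : Type*} [CommRing R]

/-- `v` is the leader of `f`: the highest ranked derivative that appears in `f`. -/
def IsLeader (r : Ranking σ) (f : DiffPoly σ R) (v : σ × ℕ) : Prop :=
  v ∈ f.vars ∧ ∀ w ∈ f.vars, w ≠ v → r.lt w v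

/-- The leading coefficient of `f` as a polynomial in the variable `v`; it is the initial of `f` if
`v` is the leader. -/
def initialAt (f : DiffPoly σ R) (v : σ × ℕ) : DiffPoly σ R :=
  ∑ m ∈ f.support with m v = f.degreeOf v, monomial (m.erase v) (coeff m f)

/-- `∂f/∂v`; it is the separant of `f` if `v` is the leader. -/
def separantAt (f : DiffPoly σ R) (v : σ × ℕ) : DiffPoly σ R := pderiv v f

variable [Differential R]

/-- `[S]`, the differential ideal generated by `S`. -/
def diffIdeal (S : Set (DiffPoly σ R)) : Ideal (DiffPoly σ R) :=
  Ideal.span {g | ∃ f ∈ S, ∃ k : ℕ, g = iterDeriv k f}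

/-- The saturation ideal `sat(A) = [A] : H_A^∞`, where `H_A` is the product of the initial and the
separant of the nonconstant `A` under the ranking `r`. -/
def sat (r : Ranking σ) (A : DiffPoly σ R) : Set (DiffPoly σ R) :=
  {f | ∃ v, IsLeader r A v ∧
    ∃ m : ℕ, (separantAt A v * initialAt A v) ^ m * f ∈ diffIdeal {A}}

end Saturation

section Parametrization

variable {F E : Type*} [Field F] [Differential F] [Field E] [Differential E] [Algebra F E]

/-- The point `(P₁(u)/Q₁(u), P₂(u)/Q₂(u))`. -/
def paramPoint (u : E) (P Q : Fin 2 → DiffPoly Unit F) : Fin 2 → E :=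
  fun i => diffEval (fun _ => u) (P i) / diffEval (fun _ => u) (Q i)

/-- The order of the fraction `P/Q`, which is meant to be in reduced form. -/
def ordFrac (P Q : DiffPoly Unit F) : WithBot ℕ := max (ord P) (ord Q)

/-- `(P₁(u)/Q₁(u), P₂(u)/Q₂(u))`, with both fractions in reduced form, is a differential rational
parametrization of the differential curve `(𝒞, A)`, that is, a generic point of the general
component `𝒞 = 𝕍(sat(A))` of the irreducible differential polynomial `A`. -/
structure IsDiffRatParam (r : Ranking (Fin 2)) (A : DiffPoly (Fin 2) F) (u : E)
    (P Q : Fin 2 → DiffPoly Unit F) : Prop where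
  irreducible : Irreducible A
  transcendental : DiffTranscendental F u
  den_ne_zero : ∀ i, Q i ≠ 0
  reduced : ∀ i, IsRelPrime (P i) (Q i)
  generic : IsGenericPoint (paramPoint u P Q) (sat r A)

/-- All numerators and denominators have (total) degree at most one. -/
def IsLinearParam (P Q : Fin 2 → DiffPoly Unit F) : Prop :=
  ∀ i, (P i).totalDegree ≤ 1 ∧ (Q i).totalDegree ≤ 1

/-- The parametrization is proper: `F⟨P₁(u)/Q₁(u), P₂(u)/Q₂(u)⟩ = F⟨u⟩`. -/
def IsProperParam (u : E) (P Q : Fin 2 → DiffPoly Unit F) : Prop :=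
  diffAdjoin F (Set.range (paramPoint u P Q)) = diffAdjoin F {u}

end Parametrization

section Resultant

variable {D : Type*} [CommRing D] [Differential D]

/-- The differential resultant matrix of linear differential polynomials `f₁`, `f₂` in `u` of
orders `m₁`, `m₂`. The rows are the coefficient vectors of
`f₁^{(m₂)}, …, f₁', f₁, f₂^{(m₁)}, …, f₂', f₂` with respect to `u^{(m₁+m₂)}, …, u', u, 1`. -/
def diffResMatrix (m₁ m₂ : ℕ) (f₁ f₂ : DiffPoly Unit D) :
    Matrix (Fin (m₁ + m₂ + 2)) (Fin (m₁ + m₂ + 2)) D :=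
  Matrix.of fun i j =>
    coeff (if (j : ℕ) ≤ m₁ + m₂ then Finsupp.single ((), m₁ + m₂ - (j : ℕ)) 1 else 0)
      (if (i : ℕ) ≤ m₂ then iterDeriv (m₂ - (i : ℕ)) f₁
        else iterDeriv (m₁ + m₂ + 1 - (i : ℕ)) f₂)

/-- The differential resultant of two nonconstant linear differential polynomials in `u`. -/
def diffRes (f₁ f₂ : DiffPoly Unit D) : D :=
  (diffResMatrix ((ord f₁).unbotD 0) ((ord f₂).unbotD 0) f₁ f₂).det

end Resultant

section Implicit

variable {F : Type*} [Field F]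

/-- For `z = x` (`i = 0`) or `z = y` (`i = 1`), the differential polynomial `z Q(u) - P(u)` in `u`
over `F{x, y}`. -/
def implicitEq (i : Fin 2) (P Q : DiffPoly Unit F) : DiffPoly Unit (DiffPoly (Fin 2) F) :=
  C (X (i, 0)) * map C Q - map C P

/-- `A` is the main irreducible factor of `R`. -/
def IsMainIrreducibleFactor (A R : DiffPoly (Fin 2) F) : Prop :=
  Irreducible A ∧ A ∣ R ∧ ∀ B, R = A * B → ord B < ord R

end Implicit

end DiffAlg

end

/-!
Let `η = (P₁(u)/Q₁(u), P₂(u)/Q₂(u))`. Elements of `F⟨u⟩` have differentials, which are linear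
differential operators applied to `du`; up to a unit, the differential of `ηᵢ` is the linear part
`Lᵢ` of `ηᵢ Qᵢ - Pᵢ`, an operator of order `mᵢ`. If the parametrization is proper then `u` is a
differential rational function of `η`, so `L₁` and `L₂` generate the unit left ideal, and a
dimension count modulo the left ideal of `L₂` (of codimension `m₂`) shows that the `∂ᵏ L₁` with
`k < m₂` and all the `∂ᵏ L₂` are linearly independent; likewise with the roles exchanged.

The resultant `R` vanishes at `η` because `u` is a common zero of the `ηᵢ Qᵢ - Pᵢ`. The highest
derivatives `x^(m₂)` and `y^(m₁)` each occur in a single row of the matrix, so `R` is linear in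
either of them, and its partial derivative is the determinant with that row replaced by the
coefficients of `Qᵢ`; at `η` this is nonzero, since the other rows are independent and vanish at
`u` whereas `Qᵢ(u) ≠ 0`. By the independence again, `A` has order at least `m₂` in `x` or at least
`m₁` in `y`, according to its leader, so `R` is reduced by `A` without differentiating `A`, and `A`
divides `R`. If `R = A B`, then the product rule and `A(η) = 0` show that `A` involves both
highest derivatives, and `B` neither.
-/

noncomputable section

namespace DiffAlg

open scoped Polynomial

section IterDeriv

variable {R : Type*} [CommRing R] [Differential R]

lemma iterDeriv_zero (a : R) : iterDeriv 0 a = a := rfl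

lemma iterDeriv_succ (k : ℕ) (a : R) :
    iterDeriv (k + 1) a = Differential.deriv (iterDeriv k a) :=
  Function.iterate_succ_apply' _ _ _

end IterDeriv

section LinearAlgebra

lemma finrank_le_of_disjoint_of_codisjoint {K V : Type*} [DivisionRing K] [AddCommGroup V]
    [Module K V] {A B C : Submodule K V} [FiniteDimensional K C] (hAB : Disjoint A B)
    (hAC : Codisjoint A C) :
    Module.finrank K B ≤ Module.finrank K C := by
  have hinj : Function.Injective (A.mkQ.domRestrict B) :=
    LinearMap.injective_domRestrict_iff.2 (by rw [Submodule.ker_mkQ]; exact hAB.symm)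
  have hsurj : Function.Surjective (A.mkQ.domRestrict C) :=
    (LinearMap.surjective_domRestrict_iff A.mkQ_surjective).2
      (by rw [Submodule.ker_mkQ]; exact hAC.symm)
  have := Module.Finite.of_surjective _ hsurj
  exact (LinearMap.finrank_le_finrank_of_injective hinj).trans
    (LinearMap.finrank_le_finrank_of_surjective hsurj)

end LinearAlgebra

/-! ### Linear differential operators -/

section Operators

variable {R : Type*} [CommRing R] [Differential R]

/-- The map `ω ↦ ∂ ∘ ω` on linear differential operators, the operator `∑ ωₖ ∂ᵏ` being encoded as
the polynomial `∑ ωₖ Xᵏ`. -/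
def derivComp : R[X] →+ R[X] :=
  (Differential.mapCoeffs : Derivation ℤ R[X] R[X]).toLinearMap.toAddMonoidHom +
    AddMonoidHom.mulLeft Polynomial.X

lemma derivComp_apply (ω : R[X]) :
    derivComp ω = Differential.mapCoeffs ω + Polynomial.X * ω := rfl

lemma derivComp_mul (f ω : R[X]) :
    derivComp (f * ω) = f * derivComp ω + Differential.mapCoeffs f * ω := by
  simp only [derivComp_apply, Derivation.leibniz, smul_eq_mul]
  ring

lemma derivComp_smul (a : R) (ω : R[X]) :
    derivComp (a • ω) = a • derivComp ω + Differential.deriv a • ω := by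
  simp only [Polynomial.smul_eq_C_mul, derivComp_mul, Differential.mapCoeffs_C]

lemma derivComp_X_pow (k : ℕ) : derivComp (Polynomial.X ^ k : R[X]) = Polynomial.X ^ (k + 1) := by
  simp [derivComp_apply, Derivation.leibniz_pow, pow_succ']

lemma degree_derivComp (ω : R[X]) : (derivComp ω).degree = ω.degree + 1 := by
  nontriviality R
  rcases eq_or_ne ω 0 with rfl | hω
  · simp
  have hX : (Polynomial.X * ω).degree = ω.degree + 1 := by
    rw [mul_comm, Polynomial.degree_mul_X]
  have hmap : (Differential.mapCoeffs ω).degree ≤ ω.degree :=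
    (Polynomial.degree_le_iff_coeff_zero _ _).2 fun k hk => by
      rw [Differential.coeff_mapCoeffs, Polynomial.coeff_eq_zero_of_degree_lt hk, map_zero]
  rw [derivComp_apply, Polynomial.degree_add_eq_right_of_degree_lt, hX]
  rw [hX, Polynomial.degree_eq_natDegree hω] at *
  exact hmap.trans_lt (by exact_mod_cast Nat.lt_succ_self _)

lemma degree_derivComp_iterate (k : ℕ) (ω : R[X]) :
    (derivComp^[k] ω).degree = ω.degree + k := by
  induction k with
  | zero => simp
  | succ k ih =>
    rw [Function.iterate_succ_apply', degree_derivComp, ih, Nat.cast_succ, add_assoc]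

lemma map_derivComp_iterate {S : Type*} [CommRing S] [Differential S] {φ : R →+* S}
    (hφ : ∀ a, φ (Differential.deriv a) = Differential.deriv (φ a)) (k : ℕ) (ω : R[X]) :
    (derivComp^[k] ω).map φ = derivComp^[k] (ω.map φ) := by
  induction k with
  | zero => rfl
  | succ k ih =>
    rw [Function.iterate_succ_apply', Function.iterate_succ_apply', ← ih]
    ext n
    simp [derivComp_apply, Polynomial.coeff_map, hφ, Polynomial.map_mul]

end Operators

section LeftIdeals

variable {R : Type*} [CommRing R] [Differential R]

lemma derivComp_mem_of_mem_span {s : Set R[X]} {U : Submodule R R[X]} (hsU : s ⊆ U)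
    (hs : ∀ ω ∈ s, derivComp ω ∈ U) {ω : R[X]} (hω : ω ∈ Submodule.span R s) :
    derivComp ω ∈ U := by
  induction hω using Submodule.span_induction with
  | mem ω hω => exact hs ω hω
  | zero => rw [map_zero]; exact U.zero_mem
  | add ω τ _ _ hω hτ => rw [map_add]; exact U.add_mem hω hτ
  | smul a ω hω' hω =>
    rw [derivComp_smul]
    exact U.add_mem (U.smul_mem _ hω) (U.smul_mem _ (Submodule.span_le.2 hsU hω'))

lemma eq_top_of_one_mem {U : Submodule R R[X]} (hU : ∀ ω ∈ U, derivComp ω ∈ U)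
    (h1 : 1 ∈ U) : U = ⊤ := by
  have hpow : ∀ k : ℕ, (Polynomial.X ^ k : R[X]) ∈ U := fun k => by
    induction k with
    | zero => rwa [pow_zero]
    | succ k ih => rw [← derivComp_X_pow]; exact hU _ ih
  refine eq_top_iff.2 fun ω _ => ?_
  induction ω using Polynomial.induction_on' with
  | add ω τ hω hτ => exact U.add_mem (hω trivial) (hτ trivial)
  | monomial k a => rw [← Polynomial.smul_X_eq_monomial]; exact U.smul_mem a (hpow k)

/-- The left ideal of the ring of linear differential operators that is generated by `s`. -/
def leftIdeal (s : Set R[X]) : Submodule R R[X] :=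
  Submodule.span R (Set.image2 (fun k ω => derivComp^[k] ω) Set.univ s)

lemma leftIdeal_singleton (ω : R[X]) :
    leftIdeal {ω} = Submodule.span R (Set.range fun k => derivComp^[k] ω) := by
  rw [leftIdeal, Set.image2_singleton_right, Set.image_univ]

lemma subset_leftIdeal (s : Set R[X]) : s ⊆ leftIdeal s :=
  fun ω hω => Submodule.subset_span ⟨0, trivial, ω, hω, rfl⟩

lemma leftIdeal_le {U : Submodule R R[X]} (hU : ∀ ω ∈ U, derivComp ω ∈ U) {s : Set R[X]}
    (hs : s ⊆ U) : leftIdeal s ≤ U := by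
  rw [leftIdeal, Submodule.span_le]
  rintro _ ⟨k, -, ω, hω, rfl⟩
  exact Set.MapsTo.iterate (s := (U : Set R[X])) hU k (hs hω)

lemma derivComp_mem_leftIdeal {s : Set R[X]} {ω : R[X]} (hω : ω ∈ leftIdeal s) :
    derivComp ω ∈ leftIdeal s := by
  refine derivComp_mem_of_mem_span Submodule.subset_span ?_ hω
  rintro _ ⟨k, -, ω, hω, rfl⟩
  exact Submodule.subset_span ⟨k + 1, trivial, ω, hω, Function.iterate_succ_apply' derivComp k ω⟩

end LeftIdeals

section LeftIdealsOverFields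

variable {K : Type*} [Field K] [Differential K]

lemma degree_sum_smul_derivComp_iterate {ω : K[X]} (hω : ω ≠ 0) (a : ℕ →₀ K) :
    (a.sum fun k c => c • derivComp^[k] ω).degree =
      a.support.sup fun k => ω.degree + (k : WithBot ℕ) := by
  have hdeg : ∀ k ∈ a.support, (a k • derivComp^[k] ω).degree = ω.degree + k := fun k hk => by
    rw [Polynomial.smul_eq_C_mul, Polynomial.degree_C_mul (Finsupp.mem_support_iff.1 hk),
      degree_derivComp_iterate]
  rw [Finsupp.sum, Polynomial.degree_sum_eq_of_disjoint]
  · exact Finset.sup_congr rfl hdeg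
  · rintro k ⟨hk, _⟩ l ⟨hl, _⟩ hkl h
    rw [Function.comp_apply, Function.comp_apply, hdeg k hk, hdeg l hl,
      Polynomial.degree_eq_natDegree hω] at h
    exact hkl (Nat.add_left_cancel (by exact_mod_cast h))

lemma linearIndependent_derivComp_iterate {ω : K[X]} (hω : ω ≠ 0) :
    LinearIndependent K fun k => derivComp^[k] ω := by
  rw [linearIndependent_iff]
  intro a ha
  rw [Finsupp.linearCombination_apply] at ha
  have hdeg := degree_sum_smul_derivComp_iterate hω a
  rw [ha, Polynomial.degree_zero, eq_comm, Finset.sup_eq_bot_iff] at hdeg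
  refine Finsupp.support_eq_empty.1 (Finset.eq_empty_of_forall_notMem fun k hk => ?_)
  simpa [hω] using hdeg k hk

lemma disjoint_leftIdeal_degreeLT {ω : K[X]} {m : ℕ} (hω : ω.degree = m) :
    Disjoint (leftIdeal {ω}) (Polynomial.degreeLT K m) := by
  have hω0 : ω ≠ 0 := by rintro rfl; simp at hω
  rw [Submodule.disjoint_def]
  intro τ hτ hlt
  rw [leftIdeal_singleton] at hτ
  obtain ⟨a, rfl⟩ := Finsupp.mem_span_range_iff_exists_finsupp.1 hτ
  rw [Polynomial.mem_degreeLT, degree_sum_smul_derivComp_iterate hω0, hω] at hlt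
  suffices a = 0 by rw [this, Finsupp.sum_zero_index]
  refine Finsupp.support_eq_empty.1 (Finset.eq_empty_of_forall_notMem fun k hk => ?_)
  have hk' := (Finset.le_sup (f := fun k : ℕ => (m : WithBot ℕ) + k) hk).trans_lt hlt
  exact absurd hk' (by norm_cast; omega)

lemma not_codisjoint_leftIdeal_span {ω : K[X]} {m p : ℕ} (hω : ω.degree = m) (hp : p < m)
    (τ : Fin p → K[X]) : ¬ Codisjoint (leftIdeal {ω}) (Submodule.span K (Set.range τ)) := by
  intro hcodisjoint
  have := FiniteDimensional.span_of_finite K (Set.finite_range τ)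
  have hle := (finrank_le_of_disjoint_of_codisjoint (disjoint_leftIdeal_degreeLT hω)
    hcodisjoint).trans (finrank_range_le_card _)
  rw [(Polynomial.degreeLTEquiv K m).finrank_eq, Module.finrank_fin_fun, Fintype.card_fin] at hle
  exact hp.not_ge hle

lemma iterate_notMem_span {ω : Fin 2 → K[X]} {i : Fin 2} {m p : ℕ} (hp : p < m)
    (hm : (ω i.rev).degree = m) (h1 : 1 ∈ leftIdeal (Set.range ω)) :
    derivComp^[p] (ω i) ∉ Submodule.span K
      ((fun x : Fin 2 × ℕ => derivComp^[x.2] (ω x.1)) '' {x | x.1 = i → x.2 < p}) := by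
  intro hmem
  set f : Fin 2 × ℕ → K[X] := fun x => derivComp^[x.2] (ω x.1)
  set U := Submodule.span K (f '' {x | x.1 = i → x.2 < p})
  have hU_of_le : ∀ x : Fin 2 × ℕ, (x.1 = i → x.2 ≤ p) → f x ∈ U := by
    rintro ⟨j, k⟩ hx
    by_cases hjk : (j, k) = (i, p)
    · rwa [hjk]
    · refine Submodule.subset_span ⟨_, fun hj => (hx hj).lt_of_ne ?_, rfl⟩
      rintro rfl
      exact hjk (by rw [← hj])
  have hU : ∀ τ ∈ U, derivComp τ ∈ U := fun τ => by
    refine derivComp_mem_of_mem_span Submodule.subset_span ?_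
    rintro _ ⟨⟨j, k⟩, hx, rfl⟩
    exact Function.iterate_succ_apply' derivComp k (ω j) ▸ hU_of_le (j, k + 1) hx
  have hle : leftIdeal (Set.range ω) ≤ U :=
    leftIdeal_le hU (Set.range_subset_iff.2 fun j => hU_of_le (j, 0) fun _ => Nat.zero_le p)
  have hsplit : {x : Fin 2 × ℕ | x.1 = i → x.2 < p} =
      Set.range (Prod.mk i.rev) ∪ Set.range fun k : Fin p => (i, (k : ℕ)) := by
    ext ⟨j, k⟩
    fin_cases i <;> fin_cases j <;> simp [Fin.exists_iff]
  refine not_codisjoint_leftIdeal_span hm hp (fun k => f (i, k)) ?_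
  rw [codisjoint_iff, ← eq_top_of_one_mem hU (hle h1), leftIdeal_singleton,
    ← Submodule.span_union]
  simp only [U, hsplit, Set.image_union, ← Set.range_comp]
  rfl

lemma linearIndepOn_derivComp_iterate {ω : Fin 2 → K[X]} {i : Fin 2} {m : ℕ}
    (hm : (ω i.rev).degree = m) (h1 : 1 ∈ leftIdeal (Set.range ω)) :
    LinearIndepOn K (fun x : Fin 2 × ℕ => derivComp^[x.2] (ω x.1)) {x | x.1 = i → x.2 < m} := by
  suffices ∀ p ≤ m, LinearIndepOn K (fun x : Fin 2 × ℕ => derivComp^[x.2] (ω x.1))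
      {x | x.1 = i → x.2 < p} from this m le_rfl
  intro p hp
  induction p with
  | zero =>
    have hrange : {x : Fin 2 × ℕ | x.1 = i → x.2 < 0} = Set.range (Prod.mk i.rev) := by
      ext ⟨j, k⟩
      fin_cases i <;> fin_cases j <;> simp
    have hω : ω i.rev ≠ 0 := fun h => by simp [h] at hm
    have hindep := linearIndependent_derivComp_iterate hω
    rw [hrange, linearIndepOn_range_iff (Prod.mk_right_injective i.rev)]
    exact hindep
  | succ p ih =>
    have hinsert : {x : Fin 2 × ℕ | x.1 = i → x.2 < p + 1} =
        insert (i, p) {x | x.1 = i → x.2 < p} := by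
      ext ⟨j, k⟩
      by_cases hj : j = i <;> simp [hj, Nat.le_iff_lt_or_eq, or_comm]
    rw [hinsert, linearIndepOn_insert (by simp)]
    exact ⟨ih (by omega), iterate_notMem_span (by omega) hm h1⟩

end LeftIdealsOverFields

/-! ### Differential polynomials and their differentials -/

section Polynomials

variable {τ S : Type*} [CommRing S]

lemma induction_on_add_mul {p : MvPolynomial τ S → Prop} (f : MvPolynomial τ S)
    (C : ∀ a, p (C a)) (X : ∀ v, p (X v)) (add : ∀ f g, p f → p g → p (f + g))
    (mul : ∀ f g, p f → p g → p (f * g)) : p f :=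
  MvPolynomial.induction_on f C add fun f v hf => mul f _ hf (X v)

lemma pderiv_eq_zero_of_mem_supported {s : Set τ} {v : τ} (hv : v ∉ s)
    {f : MvPolynomial τ S} (hf : f ∈ supported S s) : pderiv v f = 0 :=
  pderiv_eq_zero_of_notMem_vars fun h => hv (mem_supported.1 hf h)

lemma pderiv_mem_supported {s : Set τ} (v : τ)
    {f : MvPolynomial τ S} (hf : f ∈ supported S s) : pderiv v f ∈ supported S s := by
  classical
  induction hf using Algebra.adjoin_induction with
  | mem x hx =>
    obtain ⟨w, -, rfl⟩ := hx
    rw [pderiv_X, Pi.single_apply]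
    split_ifs
    · exact one_mem _
    · exact zero_mem _
  | algebraMap a => rw [algebraMap_eq, pderiv_C]; exact zero_mem _
  | add f g _ _ hf hg => rw [map_add]; exact add_mem hf hg
  | mul f g hf' hg' hf hg =>
    rw [Derivation.leibniz, smul_eq_mul, smul_eq_mul]
    exact add_mem (mul_mem hf' hg) (mul_mem hg' hf)

lemma constantCoeff_pderiv (v : τ) (f : MvPolynomial τ S) :
    constantCoeff (pderiv v f) = coeff (Finsupp.single v 1) f := by
  classical
  rw [constantCoeff_eq, coeff_pderiv]
  simp

end Polynomials

section UniversalDifferential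

variable {R : Type*} [CommRing R]

/-- The universal differential `df = ∑ (∂f/∂u⁽ᵏ⁾) du⁽ᵏ⁾` on `R{u}`. Since `du⁽ᵏ⁾ = ∂ᵏ(du)`, it is
encoded as the linear differential operator `∑ (∂f/∂u⁽ᵏ⁾) Xᵏ` applied to `du`. -/
def universalDifferential : Derivation R (DiffPoly Unit R) (DiffPoly Unit R)[X] :=
  mkDerivation R fun v => Polynomial.X ^ v.2

lemma universalDifferential_X (v : Unit × ℕ) :
    universalDifferential (X v : DiffPoly Unit R) = Polynomial.X ^ v.2 :=
  mkDerivation_X ..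

lemma universalDifferential_C (a : R) : universalDifferential (C a) = 0 :=
  derivation_C _ a

lemma coeff_universalDifferential (f : DiffPoly Unit R) (k : ℕ) :
    (universalDifferential f).coeff k = pderiv ((), k) f := by
  classical
  refine DFunLike.congr_fun (derivation_ext
    (D₁ := (Polynomial.lcoeff (DiffPoly Unit R) k).compDer universalDifferential) fun v => ?_) f
  obtain ⟨⟨⟩, n⟩ := v
  simp [universalDifferential_X, Polynomial.coeff_X_pow, pderiv_X, Pi.single_apply, eq_comm]

/-- The linear part `∑ cₖ u⁽ᵏ⁾` of a differential polynomial, as the operator `∑ cₖ Xᵏ`. -/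
def linearPart : DiffPoly Unit R →ₗ[R] R[X] where
  toFun f := (universalDifferential f).map constantCoeff
  map_add' f g := by rw [map_add, Polynomial.map_add]
  map_smul' a f := by ext; simp

lemma linearPart_apply (f : DiffPoly Unit R) :
    linearPart f = (universalDifferential f).map constantCoeff := rfl

lemma coeff_linearPart (f : DiffPoly Unit R) (k : ℕ) :
    (linearPart f).coeff k = coeff (Finsupp.single ((), k) 1) f := by
  rw [linearPart_apply, Polynomial.coeff_map, coeff_universalDifferential, constantCoeff_pderiv]

variable [Differential R]

lemma universalDifferential_deriv (f : DiffPoly Unit R) :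
    universalDifferential (Differential.deriv f) = derivComp (universalDifferential f) := by
  induction f using induction_on_add_mul with
  | C a => rw [deriv_C, universalDifferential_C, universalDifferential_C, map_zero]
  | X v =>
    obtain ⟨⟨⟩, k⟩ := v
    rw [deriv_X, universalDifferential_X, universalDifferential_X, derivComp_X_pow]
  | add f g hf hg => simp only [map_add, hf, hg]
  | mul f g hf hg =>
    simp only [Derivation.leibniz, map_add, hf, hg, derivComp_smul, smul_eq_mul]
    module

lemma universalDifferential_iterDeriv (k : ℕ) (f : DiffPoly Unit R) :
    universalDifferential (iterDeriv k f) = derivComp^[k] (universalDifferential f) := by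
  induction k with
  | zero => rfl
  | succ k ih =>
    rw [iterDeriv_succ, universalDifferential_deriv, ih, Function.iterate_succ_apply']

lemma constantCoeff_deriv {σ : Type*} (f : DiffPoly σ R) :
    constantCoeff (Differential.deriv f) = Differential.deriv (constantCoeff f) := by
  induction f using induction_on_add_mul with
  | C a => simp [deriv_C]
  | X v => obtain ⟨i, k⟩ := v; simp [deriv_X]
  | add f g hf hg => simp [hf, hg]
  | mul f g hf hg => simp [hf, hg]

lemma linearPart_iterDeriv (k : ℕ) (f : DiffPoly Unit R) :
    linearPart (iterDeriv k f) = derivComp^[k] (linearPart f) := by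
  rw [linearPart_apply, universalDifferential_iterDeriv,
    map_derivComp_iterate constantCoeff_deriv, linearPart_apply]

end UniversalDifferential

section Differentials

variable {F E : Type*} [Field F] [Field E] [Differential E] [Algebra F E]

lemma diffEval_X {σ : Type*} (η : σ → E) (v : σ × ℕ) :
    diffEval η (X v : DiffPoly σ F) = iterDeriv v.2 (η v.1) := aeval_X _ _

lemma diffEval_C {σ : Type*} (η : σ → E) (a : F) :
    diffEval η (C a : DiffPoly σ F) = algebraMap F E a := aeval_C _ _

lemma diffEval_deriv [Differential F] [DifferentialAlgebra F E] {σ : Type*} (η : σ → E)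
    (f : DiffPoly σ F) :
    diffEval η (Differential.deriv f) = Differential.deriv (diffEval η f) := by
  induction f using induction_on_add_mul with
  | C a => rw [deriv_C, diffEval_C, diffEval_C, deriv_algebraMap]
  | X v =>
    obtain ⟨i, k⟩ := v
    rw [deriv_X, diffEval_X, diffEval_X, iterDeriv_succ]
  | add f g hf hg => simp [hf, hg]
  | mul f g hf hg => simp [hf, hg]

lemma DiffTranscendental.injective {u : E} (hu : DiffTranscendental F u) :
    Function.Injective (diffEval fun _ : Unit => u : DiffPoly Unit F →ₐ[F] E) :=
  AlgebraicIndependent.comp hu (fun v : Unit × ℕ => v.2) fun _ _ h => Prod.ext rfl h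

/-- The differential of `p ∈ F{u}` with its coefficients evaluated at `u`. -/
def gradient (u : E) (p : DiffPoly Unit F) : E[X] :=
  (universalDifferential p).map (diffEval fun _ => u : DiffPoly Unit F →ₐ[F] E).toRingHom

lemma gradient_C (u : E) (c : F) : gradient u (C c) = 0 := by
  rw [gradient, universalDifferential_C, Polynomial.map_zero]

lemma gradient_one (u : E) : gradient u (1 : DiffPoly Unit F) = 0 := gradient_C u 1

lemma gradient_X (u : E) (v : Unit × ℕ) :
    gradient u (X v : DiffPoly Unit F) = Polynomial.X ^ v.2 := by
  rw [gradient, universalDifferential_X, Polynomial.map_pow, Polynomial.map_X]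

lemma gradient_add (u : E) (p q : DiffPoly Unit F) :
    gradient u (p + q) = gradient u p + gradient u q := by
  rw [gradient, map_add, Polynomial.map_add, gradient, gradient]

lemma gradient_sub (u : E) (p q : DiffPoly Unit F) :
    gradient u (p - q) = gradient u p - gradient u q := by
  rw [gradient, map_sub, Polynomial.map_sub, gradient, gradient]

lemma gradient_mul (u : E) (p q : DiffPoly Unit F) :
    gradient u (p * q) =
      diffEval (fun _ => u) p • gradient u q + diffEval (fun _ => u) q • gradient u p := by
  rw [gradient, Derivation.leibniz, Polynomial.map_add, Polynomial.map_smul, Polynomial.map_smul]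
  rfl

lemma gradient_deriv [Differential F] [DifferentialAlgebra F E] (u : E) (p : DiffPoly Unit F) :
    gradient u (Differential.deriv p) = derivComp (gradient u p) := by
  rw [gradient, universalDifferential_deriv]
  exact map_derivComp_iterate (φ := (diffEval fun _ => u : DiffPoly Unit F →ₐ[F] E).toRingHom)
    (diffEval_deriv _) 1 _

variable (F) in
/-- `a = p(u)/q(u)` has differential `ω`, that is, `ω(du) = (dp - a dq)/q(u)`. -/
def HasDifferential (u a : E) (ω : E[X]) : Prop :=
  ∃ p q : DiffPoly Unit F, diffEval (fun _ => u) q ≠ 0 ∧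
    a * diffEval (fun _ => u) q = diffEval (fun _ => u) p ∧
    diffEval (fun _ => u) q • ω = gradient u p - a • gradient u q

namespace HasDifferential

variable {u a b : E} {ω θ : E[X]}

lemma algebraMap (u : E) (c : F) : HasDifferential F u (algebraMap F E c) 0 :=
  ⟨C c, 1, by simp, by simp, by simp [gradient_C, gradient_one]⟩

lemma add (ha : HasDifferential F u a ω) (hb : HasDifferential F u b θ) :
    HasDifferential F u (a + b) (ω + θ) := by
  obtain ⟨p, q, hq, hpq, h⟩ := ha
  obtain ⟨p', q', hq', hpq', h'⟩ := hb
  refine ⟨p * q' + p' * q, q * q', ?_, ?_, ?_⟩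
  · rw [map_mul]; exact mul_ne_zero hq hq'
  · simp only [map_add, map_mul]
    linear_combination diffEval (fun _ => u) q' * hpq + diffEval (fun _ => u) q * hpq'
  · simp only [gradient_add, gradient_mul, map_mul, ← hpq, ← hpq']
    linear_combination (norm := module) diffEval (fun _ => u) q' • h + diffEval (fun _ => u) q • h'

lemma mul (ha : HasDifferential F u a ω) (hb : HasDifferential F u b θ) :
    HasDifferential F u (a * b) (a • θ + b • ω) := by
  obtain ⟨p, q, hq, hpq, h⟩ := ha
  obtain ⟨p', q', hq', hpq', h'⟩ := hb
  refine ⟨p * p', q * q', ?_, ?_, ?_⟩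
  · rw [map_mul]; exact mul_ne_zero hq hq'
  · simp only [map_mul, ← hpq, ← hpq']
    ring
  · simp only [gradient_mul, map_mul, ← hpq, ← hpq']
    linear_combination (norm := module) (b * diffEval (fun _ => u) q') • h +
      (a * diffEval (fun _ => u) q) • h'

lemma inv (ha : HasDifferential F u a ω) (h0 : a ≠ 0) :
    HasDifferential F u a⁻¹ (-(a⁻¹ * a⁻¹) • ω) := by
  obtain ⟨p, q, hq, hpq, h⟩ := ha
  refine ⟨q, p, ?_, ?_, ?_⟩
  · rw [← hpq]; exact mul_ne_zero h0 hq
  · rw [← hpq, inv_mul_cancel_left₀ h0]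
  · have hscalar : a * diffEval (fun _ => u) q * -(a⁻¹ * a⁻¹) =
        -a⁻¹ * diffEval (fun _ => u) q := by field_simp
    rw [← hpq, smul_smul, hscalar, mul_smul, h, smul_sub, smul_smul, neg_mul, inv_mul_cancel₀ h0]
    module

lemma deriv [Differential F] [DifferentialAlgebra F E] (ha : HasDifferential F u a ω) :
    HasDifferential F u (Differential.deriv a) (derivComp ω) := by
  obtain ⟨p, q, hq, hpq, h⟩ := ha
  have hpq' := congrArg (⇑(Differential.deriv : Derivation ℤ E E)) hpq
  have h' := congrArg derivComp h
  rw [Derivation.leibniz, smul_eq_mul, smul_eq_mul] at hpq'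
  rw [map_sub, derivComp_smul, derivComp_smul] at h'
  refine ⟨Differential.deriv p * q - p * Differential.deriv q, q * q, ?_, ?_, ?_⟩
  · rw [map_mul]; exact mul_ne_zero hq hq
  · simp only [map_sub, map_mul, diffEval_deriv]
    rw [← hpq', ← hpq]
    ring
  · simp only [gradient_sub, gradient_mul, gradient_deriv, map_mul, diffEval_deriv]
    rw [← hpq', ← hpq]
    linear_combination (norm := module) diffEval (fun _ => u) q • h' -
      Differential.deriv (diffEval (fun _ => u) q) • h

lemma iterDeriv [Differential F] [DifferentialAlgebra F E] (ha : HasDifferential F u a ω)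
    (k : ℕ) : HasDifferential F u (iterDeriv k a) (derivComp^[k] ω) := by
  induction k with
  | zero => exact ha
  | succ k ih => rw [iterDeriv_succ, Function.iterate_succ_apply']; exact ih.deriv

lemma div {p q : DiffPoly Unit F} (hq : diffEval (fun _ => u) q ≠ 0) :
    HasDifferential F u (diffEval (fun _ => u) p / diffEval (fun _ => u) q)
      ((diffEval (fun _ => u) q)⁻¹ •
        (gradient u p - (diffEval (fun _ => u) p / diffEval (fun _ => u) q) • gradient u q)) :=
  ⟨p, q, hq, div_mul_cancel₀ _ hq, smul_inv_smul₀ hq _⟩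

lemma eq_zero (hu : DiffTranscendental F u) (h : HasDifferential F u 0 ω) : ω = 0 := by
  obtain ⟨p, q, hq, hpq, h⟩ := h
  have hp : p = C 0 := hu.injective (by rw [← hpq, zero_mul, map_zero, map_zero])
  rw [hp, gradient_C, zero_smul, sub_zero] at h
  exact (smul_eq_zero.1 h).resolve_left hq

lemma unique (hu : DiffTranscendental F u) (h : HasDifferential F u a ω)
    (h' : HasDifferential F u a θ) : ω = θ := by
  have hsub := h.add ((algebraMap u (-1 : F)).mul h')
  simp only [map_neg, map_one, neg_mul, one_mul, add_neg_cancel, smul_zero, add_zero,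
    neg_smul, one_smul] at hsub
  exact sub_eq_zero.1 ((sub_eq_add_neg ω θ).trans (hsub.eq_zero hu))

lemma self (u : E) : HasDifferential F u u 1 :=
  ⟨X ((), 0), 1, by simp, by simp [diffEval_X, iterDeriv_zero], by simp [gradient_X, gradient_one]⟩

lemma of_mem_diffAdjoin [Differential F] [DifferentialAlgebra F E] {W : Submodule E E[X]}
    (hW : ∀ ω ∈ W, derivComp ω ∈ W) {S : Set E} (hS : ∀ s ∈ S, ∃ ω ∈ W, HasDifferential F u s ω)
    (ha : a ∈ diffAdjoin F S) : ∃ ω ∈ W, HasDifferential F u a ω := by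
  induction ha using IntermediateField.adjoin_induction with
  | mem x hx =>
    obtain ⟨s, hs, k, rfl⟩ := hx
    obtain ⟨ω, hω, hs⟩ := hS s hs
    exact ⟨_, Set.MapsTo.iterate (s := (W : Set E[X])) hW k hω, hs.iterDeriv k⟩
  | algebraMap c => exact ⟨0, zero_mem _, algebraMap u c⟩
  | add x y _ _ hx hy =>
    obtain ⟨ω, hω, hx⟩ := hx
    obtain ⟨θ, hθ, hy⟩ := hy
    exact ⟨_, add_mem hω hθ, hx.add hy⟩
  | inv x _ hx =>
    obtain ⟨ω, hω, hx⟩ := hx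
    by_cases h : x = 0
    · rw [h, inv_zero]
      exact ⟨0, zero_mem _, by simpa using algebraMap u (0 : F)⟩
    · exact ⟨_, W.smul_mem _ hω, hx.inv h⟩
  | mul x y _ _ hx hy =>
    obtain ⟨ω, hω, hx⟩ := hx
    obtain ⟨θ, hθ, hy⟩ := hy
    exact ⟨_, add_mem (W.smul_mem _ hθ) (W.smul_mem _ hω), hx.mul hy⟩

/-- The chain rule, with the differentials of all the derivatives but `v` absorbed into `U`. -/
lemma diffEval_of_mem_supported {σ : Type*} {η : σ → E} {s : Set (σ × ℕ)} {v : σ × ℕ}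
    {U : Submodule E E[X]}
    (hs : ∀ w ∈ s, w ≠ v → ∃ θ ∈ U, HasDifferential F u (DiffAlg.iterDeriv w.2 (η w.1)) θ)
    (hv : HasDifferential F u (DiffAlg.iterDeriv v.2 (η v.1)) ω)
    {f : DiffPoly σ F} (hf : f ∈ supported F s) :
    ∃ θ ∈ U, HasDifferential F u (diffEval η f) (diffEval η (pderiv v f) • ω + θ) := by
  classical
  induction hf using Algebra.adjoin_induction with
  | mem x hx =>
    obtain ⟨w, hw, rfl⟩ := hx
    rw [diffEval_X, pderiv_X]
    by_cases h : w = v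
    · subst h
      exact ⟨0, zero_mem _, by simpa using hv⟩
    · obtain ⟨θ, hθ, hw⟩ := hs w hw h
      refine ⟨θ, hθ, ?_⟩
      rwa [Pi.single_eq_of_ne h, map_zero, zero_smul, zero_add]
  | algebraMap c =>
    refine ⟨0, zero_mem _, ?_⟩
    rw [algebraMap_eq, pderiv_C, map_zero, zero_smul, zero_add, diffEval_C]
    exact algebraMap u c
  | add f g _ _ hf hg =>
    obtain ⟨θ, hθ, hf⟩ := hf
    obtain ⟨τ, hτ, hg⟩ := hg
    refine ⟨_, add_mem hθ hτ, ?_⟩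
    rw [map_add, map_add, map_add]
    convert hf.add hg using 1
    module
  | mul f g _ _ hf hg =>
    obtain ⟨θ, hθ, hf⟩ := hf
    obtain ⟨τ, hτ, hg⟩ := hg
    refine ⟨_, add_mem (U.smul_mem (diffEval η f) hτ)
      (U.smul_mem (diffEval η g) hθ), ?_⟩
    rw [Derivation.leibniz, smul_eq_mul, smul_eq_mul, map_add, map_mul, map_mul, map_mul]
    convert hf.mul hg using 1
    module

end HasDifferential

end Differentials

/-! ### Orders and reduction -/

section Orders

variable {σ R : Type*} [CommRing R] [Differential R]

lemma deriv_mem_supported {s t : Set (σ × ℕ)} (hst : s ⊆ t)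
    (hs : ∀ v ∈ s, (v.1, v.2 + 1) ∈ t) {f : DiffPoly σ R} (hf : f ∈ supported R s) :
    Differential.deriv f ∈ supported R t := by
  have hle := supported_mono (R := R) hst
  induction hf using Algebra.adjoin_induction with
  | mem x hx =>
    obtain ⟨⟨i, k⟩, hv, rfl⟩ := hx
    rw [deriv_X]
    exact Algebra.subset_adjoin ⟨_, hs _ hv, rfl⟩
  | algebraMap a =>
    rw [algebraMap_eq, deriv_C]
    exact Subalgebra.algebraMap_mem _ _
  | add f g _ _ hf hg => rw [map_add]; exact add_mem hf hg
  | mul f g hf' hg' hf hg =>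
    rw [Derivation.leibniz, smul_eq_mul, smul_eq_mul]
    exact add_mem (mul_mem (hle hf') hg) (mul_mem (hle hg') hf)

/-- The derivatives of the indeterminate `i` up to order `n`, and all derivatives of the others. -/
def ordLE (i : σ) (n : ℕ) : Set (σ × ℕ) := {v | v.1 = i → v.2 ≤ n}

lemma ordLE_mono (i : σ) {n m : ℕ} (h : n ≤ m) : ordLE i n ⊆ ordLE i m :=
  fun _ hv hi => (hv hi).trans h

lemma notMem_ordLE (i : σ) {n m : ℕ} (h : n < m) : (i, m) ∉ ordLE i n :=
  fun hm => h.not_ge (hm rfl)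

lemma deriv_sub_mem_supported (i : σ) (n : ℕ) {f : DiffPoly σ R}
    (hf : f ∈ supported R (ordLE i n)) :
    Differential.deriv f - pderiv (i, n) f * X (i, n + 1) ∈ supported R (ordLE i n) := by
  classical
  induction hf using Algebra.adjoin_induction with
  | mem x hx =>
    obtain ⟨⟨j, k⟩, hv, rfl⟩ := hx
    rw [deriv_X, pderiv_X]
    by_cases h : (j, k) = (i, n)
    · obtain ⟨rfl, rfl⟩ := Prod.mk.inj h
      simp
    · rw [Pi.single_eq_of_ne h, zero_mul, sub_zero]
      refine Algebra.subset_adjoin ⟨(j, k + 1), fun hj => ?_, rfl⟩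
      refine Nat.succ_le_of_lt ((hv hj).lt_of_ne ?_)
      rintro rfl
      exact h (by rw [← hj])
  | algebraMap a =>
    rw [algebraMap_eq, deriv_C, pderiv_C, zero_mul, sub_zero]
    exact Subalgebra.algebraMap_mem _ _
  | add f g _ _ hf hg =>
    rw [map_add, map_add]
    convert add_mem hf hg using 1
    ring
  | mul f g hf' hg' hf hg =>
    have hleibniz : Differential.deriv (f * g) - pderiv (i, n) (f * g) * X (i, n + 1) =
        f * (Differential.deriv g - pderiv (i, n) g * X (i, n + 1)) +
          g * (Differential.deriv f - pderiv (i, n) f * X (i, n + 1)) := by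
      simp only [Derivation.leibniz, smul_eq_mul]
      ring
    rw [hleibniz]
    exact add_mem (mul_mem hf' hg) (mul_mem hg' hf)

lemma iterDeriv_mem_supported (i : σ) (n : ℕ) {f : DiffPoly σ R}
    (hf : f ∈ supported R (ordLE i n)) (k : ℕ) :
    iterDeriv k f ∈ supported R (ordLE i (n + k)) := by
  induction k with
  | zero => exact hf
  | succ k ih =>
    rw [iterDeriv_succ]
    exact deriv_mem_supported (ordLE_mono i (by omega))
      (fun v hv hi => Nat.succ_le_succ (hv hi)) ih

lemma iterDeriv_succ_sub_mem_supported (i : σ) (n : ℕ) {f : DiffPoly σ R}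
    (hf : f ∈ supported R (ordLE i n)) (k : ℕ) :
    iterDeriv (k + 1) f - pderiv (i, n) f * X (i, n + k + 1) ∈ supported R (ordLE i (n + k)) := by
  induction k with
  | zero => exact deriv_sub_mem_supported i n hf
  | succ k ih =>
    have hsep : pderiv (i, n + k + 1) (pderiv (i, n) f) = 0 :=
      pderiv_eq_zero_of_mem_supported (notMem_ordLE i (by omega)) (pderiv_mem_supported _ hf)
    have hpderiv := pderiv_eq_zero_of_mem_supported (notMem_ordLE i (Nat.lt_succ_self _)) ih
    rw [map_sub, Derivation.leibniz, hsep, pderiv_X_self, smul_zero, add_zero, smul_eq_mul,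
      mul_one, sub_eq_zero] at hpderiv
    rw [iterDeriv_succ, ← hpderiv]
    exact deriv_sub_mem_supported i (n + k + 1) (iterDeriv_mem_supported i n hf (k + 1))

end Orders

section Leaders

variable {σ R : Type*} [CommRing R] {r : Ranking σ} {A : DiffPoly σ R}

lemma IsLeader.mem_supported_ordLE {i : σ} {n : ℕ} (h : IsLeader r A (i, n)) :
    A ∈ supported R (ordLE i n) := by
  rw [mem_supported]
  rintro ⟨j, k⟩ hv (rfl : j = i)
  change k ≤ n
  have := r.isStrictTotalOrder
  have hlt : ∀ d, r.lt (j, n) (j, n + d + 1) := fun d => by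
    induction d with
    | zero => exact r.lt_deriv _
    | succ d ih => exact trans_of r.lt ih (r.lt_deriv _)
  by_contra! hk
  obtain ⟨d, rfl⟩ := Nat.exists_eq_add_of_lt hk
  exact asymm_of r.lt (h.2 _ hv (by simp; omega)) (hlt d)

lemma IsLeader.unique {v w : σ × ℕ} (hv : IsLeader r A v) (hw : IsLeader r A w) : v = w := by
  have := r.isStrictTotalOrder
  by_contra h
  exact asymm_of r.lt (hv.2 w hw.1 (Ne.symm h)) (hw.2 v hv.1 h)

lemma initialAt_mem_supported {s : Set (σ × ℕ)} (hA : A ∈ supported R s) (v : σ × ℕ) :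
    initialAt A v ∈ supported R s := by
  classical
  refine sum_mem fun m hm => mem_supported.2 fun w hw => ?_
  obtain ⟨hm, -⟩ := Finset.mem_filter.1 hm
  rw [vars_monomial (mem_support_iff.1 hm), Finsupp.support_erase] at hw
  exact mem_supported.1 hA
    ((mem_vars_iff_mem_support w).2 ⟨m, hm, Finset.mem_of_mem_erase hw⟩)

end Leaders

section Reduction

variable {σ R : Type*} [CommRing R]

lemma aeval_congr_of_mem_supported {τ L : Type*} [CommRing L] [Algebra R L] {s : Set τ}
    {x y : τ → L} (h : Set.EqOn x y s) {f : MvPolynomial τ R} (hf : f ∈ supported R s) :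
    aeval x f = aeval y f :=
  AlgHom.eqOn_adjoin_iff.2 (by rintro _ ⟨v, hv, rfl⟩; simp [h hv]) hf

lemma exists_aeval_eq_zero_iff_dvd.{v, w} {τ : Type v} {R : Type w} [CommRing R]
    {A : MvPolynomial τ R} (hA : Prime A) :
    ∃ (L : Type (max v w)) (_ : Field L) (_ : Algebra R L) (x : τ → L),
      ∀ f, aeval x f = 0 ↔ A ∣ f := by
  have : (Ideal.span {A}).IsPrime := (Ideal.span_singleton_prime hA.ne_zero).2 hA
  let L := FractionRing (MvPolynomial τ R ⧸ Ideal.span {A})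
  let φ : MvPolynomial τ R →ₐ[R] L :=
    (IsScalarTower.toAlgHom R (MvPolynomial τ R ⧸ Ideal.span {A}) L).comp
      (Ideal.Quotient.mkₐ R (Ideal.span {A}))
  refine ⟨L, inferInstance, inferInstance, fun v => φ (X v), fun f => ?_⟩
  rw [← comp_aeval_apply, aeval_X_left_apply]
  change algebraMap _ L (Ideal.Quotient.mk (Ideal.span {A}) f) = 0 ↔ _
  rw [FaithfulSMul.algebraMap_eq_zero_iff, Ideal.Quotient.eq_zero_iff_mem,
    Ideal.mem_span_singleton]

variable [Differential R]

/-- The `k`-th derivative of `A` is linear in the `k`-th derivative of the leader, with the separant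
as its leading coefficient, so the values of the derivatives of the leader can be chosen one after
the other. -/
lemma exists_aeval_iterDeriv_eq_zero {L : Type*} [Field L] [Algebra R L] {A : DiffPoly σ R}
    {i : σ} {n : ℕ} (hA : A ∈ supported R (ordLE i n)) {x : σ × ℕ → L} (hx : aeval x A = 0)
    (hS : aeval x (pderiv (i, n) A) ≠ 0) (N : ℕ) :
    ∃ y : σ × ℕ → L, Set.EqOn y x (ordLE i n) ∧ ∀ k ≤ N, aeval y (iterDeriv k A) = 0 := by
  classical
  induction N with
  | zero => exact ⟨x, fun _ _ => rfl, fun k hk => by rwa [Nat.le_zero.1 hk]⟩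
  | succ N ih =>
    obtain ⟨y, hyx, hy⟩ := ih
    set S := pderiv (i, n) A
    obtain ⟨T, hT⟩ : ∃ T, T = iterDeriv (N + 1) A - S * X (i, n + N + 1) := ⟨_, rfl⟩
    have hTmem := iterDeriv_succ_sub_mem_supported i n hA N
    rw [← hT] at hTmem
    set z := Function.update y (i, n + N + 1) (-aeval y T / aeval x S) with hz
    have hzy : Set.EqOn z y (ordLE i (n + N)) := fun v hv =>
      Function.update_of_ne (fun h => notMem_ordLE i (Nat.lt_succ_self _) (h ▸ hv)) ..
    have hzx : Set.EqOn z x (ordLE i n) := (hzy.mono (ordLE_mono i (by omega))).trans hyx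
    refine ⟨z, hzx, fun k hk => ?_⟩
    rcases Nat.le_succ_iff.1 hk with hk | rfl
    · rw [aeval_congr_of_mem_supported hzy
        (supported_mono (ordLE_mono i (by omega)) (iterDeriv_mem_supported i n hA k))]
      exact hy k hk
    · rw [← sub_add_cancel (iterDeriv (N + 1) A) (S * X (i, n + N + 1)), ← hT, map_add, map_mul,
        aeval_X, aeval_congr_of_mem_supported hzx (pderiv_mem_supported _ hA),
        aeval_congr_of_mem_supported hzy hTmem, hz, Function.update_self, mul_div_cancel₀ _ hS,
        add_neg_cancel]

lemma exists_mem_span_of_mem_diffIdeal {A f : DiffPoly σ R} (hf : f ∈ diffIdeal {A}) :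
    ∃ N, f ∈ Ideal.span ((fun k => iterDeriv k A) '' Set.Iic N) := by
  have hmono : Monotone fun N => Ideal.span ((fun k => iterDeriv k A) '' Set.Iic N) :=
    fun _ _ h => Ideal.span_mono (Set.image_mono (Set.Iic_subset_Iic.2 h))
  rw [← Submodule.mem_iSup_of_directed _ hmono.directed_le]
  refine Ideal.span_le.2 ?_ hf
  rintro _ ⟨_, rfl, k, rfl⟩
  exact Submodule.mem_iSup_of_mem k (Ideal.subset_span ⟨k, Set.self_mem_Iic, rfl⟩)

lemma dvd_of_mem_sat {r : Ranking σ} {A f : DiffPoly σ R} (hA : Prime A) {i : σ} {n : ℕ}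
    (hl : IsLeader r A (i, n)) (hH : ¬ A ∣ separantAt A (i, n) * initialAt A (i, n))
    (hf : f ∈ sat r A) (hfn : f ∈ supported R (ordLE i n)) : A ∣ f := by
  obtain ⟨v, hv, m, hm⟩ := hf
  obtain rfl := hl.unique hv
  have hAmem := hl.mem_supported_ordLE
  obtain ⟨L, _, _, x, hx⟩ := exists_aeval_eq_zero_iff_dvd hA
  obtain ⟨N, hN⟩ := exists_mem_span_of_mem_diffIdeal hm
  obtain ⟨y, hyx, hy⟩ := exists_aeval_iterDeriv_eq_zero hAmem ((hx A).2 dvd_rfl)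
    (fun h => hH (dvd_mul_of_dvd_left ((hx _).1 h) _)) N
  have hzero : aeval y ((separantAt A (i, n) * initialAt A (i, n)) ^ m * f) = 0 := by
    refine (Ideal.span_le (I := RingHom.ker (aeval y : DiffPoly σ R →ₐ[R] L))).2 ?_ hN
    rintro _ ⟨k, hk, rfl⟩
    exact hy k hk
  rw [aeval_congr_of_mem_supported hyx, hx] at hzero
  · exact (hA.dvd_or_dvd hzero).resolve_left fun h => hH (hA.dvd_of_dvd_pow h)
  · exact mul_mem (pow_mem (mul_mem (pderiv_mem_supported _ hAmem)
      (initialAt_mem_supported hAmem _)) m) hfn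

end Reduction

section GenericPoint

variable {σ F E : Type*} [Field F] [Differential F] [Field E] [Differential E] [Algebra F E]
  {r : Ranking σ} {A : DiffPoly σ F} {η : σ → E}

lemma IsGenericPoint.mem_sat_iff (h : IsGenericPoint η (sat r A)) {f : DiffPoly σ F} :
    f ∈ sat r A ↔ diffEval η f = 0 := by
  rw [← h]
  rfl

lemma IsGenericPoint.exists_isLeader (h : IsGenericPoint η (sat r A)) : ∃ v, IsLeader r A v := by
  obtain ⟨v, hv, -⟩ := h.mem_sat_iff.2 (map_zero (diffEval η))
  exact ⟨v, hv⟩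

lemma IsGenericPoint.diffEval_eq_zero (h : IsGenericPoint η (sat r A)) : diffEval η A = 0 := by
  obtain ⟨v, hv⟩ := h.exists_isLeader
  refine h.mem_sat_iff.1 ⟨v, hv, 0, ?_⟩
  rw [pow_zero, one_mul]
  exact Ideal.subset_span ⟨A, rfl, 0, rfl⟩

lemma IsGenericPoint.diffEval_separantAt_mul_initialAt_ne_zero (h : IsGenericPoint η (sat r A))
    {v : σ × ℕ} (hv : IsLeader r A v) : diffEval η (separantAt A v * initialAt A v) ≠ 0 := by
  intro h0
  obtain ⟨w, hw, m, hm⟩ := h.mem_sat_iff.2 h0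
  obtain rfl := hv.unique hw
  rw [← pow_succ] at hm
  have hone : (1 : DiffPoly σ F) ∈ sat r A := ⟨v, hv, m + 1, by rwa [mul_one]⟩
  exact one_ne_zero ((map_one _).symm.trans (h.mem_sat_iff.1 hone))

lemma IsGenericPoint.dvd_of_diffEval_eq_zero (h : IsGenericPoint η (sat r A)) (hA : Irreducible A)
    {i : σ} {n : ℕ} (hl : IsLeader r A (i, n)) {f : DiffPoly σ F} (hf : diffEval η f = 0)
    (hfn : f ∈ supported F (ordLE i n)) : A ∣ f := by
  refine dvd_of_mem_sat hA.prime hl ?_ (h.mem_sat_iff.2 hf) hfn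
  rintro ⟨B, hB⟩
  refine h.diffEval_separantAt_mul_initialAt_ne_zero hl ?_
  rw [hB, map_mul, h.diffEval_eq_zero, zero_mul]

end GenericPoint

/-! ### Linear differential polynomials and their resultant -/

section LinearPolynomials

variable {R : Type*} [CommRing R]

lemma eq_zero_or_eq_single_of_mem_support {τ : Type*} {f : MvPolynomial τ R}
    (h : f.totalDegree ≤ 1) {n : τ →₀ ℕ} (hn : n ∈ f.support) :
    n = 0 ∨ ∃ v, n = Finsupp.single v 1 := by
  have hdeg : n.degree ≤ 1 := (le_totalDegree hn).trans h
  obtain h0 | h1 := Nat.le_one_iff_eq_zero_or_eq_one.1 hdeg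
  · exact Or.inl ((Finsupp.degree_eq_zero_iff n).1 h0)
  · exact Or.inr ((Finsupp.sum_eq_one_iff n).1 h1)

lemma pderiv_of_totalDegree_le_one {τ : Type*} {f : MvPolynomial τ R} (h : f.totalDegree ≤ 1)
    (v : τ) : pderiv v f = C (coeff (Finsupp.single v 1) f) := by
  classical
  ext n
  rw [coeff_pderiv, coeff_C]
  split_ifs with hn
  · simp [← hn]
  · rw [coeff_eq_zero_of_totalDegree_lt, zero_mul]
    change _ < Finsupp.degree _
    rw [map_add, Finsupp.degree_single]
    have : n.degree ≠ 0 := fun h0 => hn ((Finsupp.degree_eq_zero_iff n).1 h0).symm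
    omega

lemma mem_vars_iff_coeff_linearPart_ne_zero {f : DiffPoly Unit R} (h : f.totalDegree ≤ 1) {k : ℕ} :
    ((), k) ∈ f.vars ↔ (linearPart f).coeff k ≠ 0 := by
  rw [coeff_linearPart, mem_vars_iff_mem_support]
  refine ⟨fun ⟨n, hn, hkn⟩ => ?_, fun hk => ⟨_, mem_support_iff.2 hk, by simp⟩⟩
  obtain rfl | ⟨v, rfl⟩ := eq_zero_or_eq_single_of_mem_support h hn
  · simp at hkn
  · obtain rfl := Finset.mem_singleton.1 (Finsupp.support_single_subset hkn)
    exact mem_support_iff.1 hn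

lemma degree_linearPart {f : DiffPoly Unit R} (h : f.totalDegree ≤ 1) :
    (linearPart f).degree = ord f := by
  classical
  have hvars : f.vars = (linearPart f).support.image (Prod.mk ()) := by
    ext ⟨⟨⟩, k⟩
    simp [mem_vars_iff_coeff_linearPart_ne_zero h]
  rw [ord, hvars, Finset.sup_image]
  rfl

lemma universalDifferential_of_totalDegree_le_one {f : DiffPoly Unit R} (h : f.totalDegree ≤ 1) :
    universalDifferential f = (linearPart f).map C := by
  ext1 k
  rw [coeff_universalDifferential, pderiv_of_totalDegree_le_one h, Polynomial.coeff_map,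
    coeff_linearPart]

/-- The exponents of the monomials `1, u, u', …, u⁽ᴺ⁾`. -/
def affineExponents (N : ℕ) : Set (Unit × ℕ →₀ ℕ) :=
  insert 0 ((fun k => Finsupp.single ((), k) 1) '' Set.Iic N)

lemma mem_restrictSupport_affineExponents {f : DiffPoly Unit R} (h : f.totalDegree ≤ 1) {N : ℕ}
    (hN : ord f ≤ N) : f ∈ restrictSupport R (affineExponents N) := by
  rw [mem_restrictSupport_iff]
  intro n hn
  obtain rfl | ⟨⟨⟨⟩, k⟩, rfl⟩ := eq_zero_or_eq_single_of_mem_support h hn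
  · exact Set.mem_insert _ _
  · have hk : ((), k) ∈ f.vars := (mem_vars_iff_mem_support _).2 ⟨_, hn, by simp⟩
    exact Set.mem_insert_of_mem _ ⟨k, by exact_mod_cast (Finset.le_sup hk).trans hN, rfl⟩

lemma restrictSupport_affineExponents_mono {M N : ℕ} (h : M ≤ N) :
    restrictSupport R (affineExponents M) ≤ restrictSupport R (affineExponents N) :=
  restrictSupport_mono _ (Set.insert_subset_insert (Set.image_mono (Set.Iic_subset_Iic.2 h)))

lemma deriv_mem_restrictSupport [Differential R] {N : ℕ} {f : DiffPoly Unit R}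
    (hf : f ∈ restrictSupport R (affineExponents N)) :
    Differential.deriv f ∈ restrictSupport R (affineExponents (N + 1)) := by
  rw [restrictSupport_eq_span] at hf
  induction hf using Submodule.span_induction with
  | mem f hf =>
    obtain ⟨_, rfl | ⟨k, hk, rfl⟩, rfl⟩ := hf
    · change Differential.deriv (C 1 : DiffPoly Unit R) ∈ _
      rw [map_one, Derivation.map_one_eq_zero]
      exact zero_mem _
    · change Differential.deriv (X ((), k) : DiffPoly Unit R) ∈ _
      rw [deriv_X]
      exact (monomial_mem_restrictSupport R).2
        (.inl (.inr ⟨k + 1, Nat.succ_le_succ hk, rfl⟩))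
  | zero => rw [map_zero]; exact zero_mem _
  | add f g _ _ hf hg => rw [map_add]; exact add_mem hf hg
  | smul a f hf' hf =>
    rw [← restrictSupport_eq_span] at hf'
    rw [smul_eq_C_mul, Derivation.leibniz, deriv_C, smul_eq_mul, smul_eq_mul, mul_comm f,
      ← smul_eq_C_mul, ← smul_eq_C_mul]
    exact add_mem (Submodule.smul_mem _ _ hf) (Submodule.smul_mem _ _
      (restrictSupport_affineExponents_mono N.le_succ hf'))

lemma iterDeriv_mem_restrictSupport [Differential R] {N : ℕ} {f : DiffPoly Unit R}
    (hf : f ∈ restrictSupport R (affineExponents N)) (k : ℕ) :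
    iterDeriv k f ∈ restrictSupport R (affineExponents (N + k)) := by
  induction k with
  | zero => exact hf
  | succ k ih => rw [iterDeriv_succ]; exact deriv_mem_restrictSupport ih

/-- The exponents of the monomials `u⁽ᴺ⁾, …, u', u, 1`, which index the columns of the differential
resultant matrix. -/
def column (N : ℕ) (b : Fin (N + 2)) : Unit × ℕ →₀ ℕ :=
  if (b : ℕ) ≤ N then Finsupp.single ((), N - b) 1 else 0

lemma column_injective (N : ℕ) : Function.Injective (column N) := by
  intro b c h
  ext
  have hb := b.isLt
  have hc := c.isLt
  simp only [column] at h
  split_ifs at h with h1 h2 h2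
  · have := (Prod.mk.inj ((Finsupp.single_left_inj one_ne_zero).1 h)).2
    omega
  · exact absurd h (Finsupp.single_ne_zero.2 one_ne_zero)
  · exact absurd h.symm (Finsupp.single_ne_zero.2 one_ne_zero)
  · omega

lemma range_column (N : ℕ) : Set.range (column N) = affineExponents N := by
  ext n
  constructor
  · rintro ⟨b, rfl⟩
    unfold column
    split_ifs
    · exact Or.inr ⟨_, Nat.sub_le N b, rfl⟩
    · exact Or.inl rfl
  · rintro (rfl | ⟨k, hk, rfl⟩)
    · exact ⟨Fin.last _, by simp [column]⟩
    · have hk : k ≤ N := hk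
      exact ⟨⟨N - k, by omega⟩, by simp [column, Nat.sub_sub_self hk]⟩

lemma sum_coeff_column_smul_monomial {N : ℕ} {f : DiffPoly Unit R}
    (hf : f ∈ restrictSupport R (affineExponents N)) :
    ∑ b, coeff (column N b) f • (monomial (column N b) 1 : DiffPoly Unit R) = f := by
  classical
  ext n
  simp only [coeff_sum, coeff_smul, coeff_monomial, smul_eq_mul, mul_ite, mul_one, mul_zero]
  by_cases hn : n ∈ Set.range (column N)
  · obtain ⟨b, rfl⟩ := hn
    simp [(column_injective N).eq_iff]
  · rw [Finset.sum_eq_zero fun b _ => if_neg fun h => hn ⟨b, h⟩, eq_comm,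
      ← notMem_support_iff]
    rw [range_column] at hn
    exact fun h => hn ((mem_restrictSupport_iff R).1 hf h)

end LinearPolynomials

section Matrices

/-- The differential resultant matrix of `f₀`, `f₁` of orders `m₀`, `m₁` has the rows `fᵢ⁽ᵏ⁾`, where
`(i, k)` are the values of this function. -/
def rowIndex (m : Fin 2 → ℕ) (a : Fin (m 0 + m 1 + 2)) : Fin 2 × ℕ :=
  if (a : ℕ) ≤ m 1 then (0, m 1 - a) else (1, m 0 + m 1 + 1 - a)

lemma rowIndex_injective (m : Fin 2 → ℕ) : Function.Injective (rowIndex m) := by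
  intro a b h
  ext
  have ha := a.isLt
  have hb := b.isLt
  simp only [rowIndex] at h
  split_ifs at h <;> simp only [Prod.mk.injEq, zero_ne_one, one_ne_zero, false_and] at h <;> omega

lemma rowIndex_snd_le (m : Fin 2 → ℕ) (a : Fin (m 0 + m 1 + 2)) :
    (rowIndex m a).2 ≤ m (rowIndex m a).1.rev := by
  unfold rowIndex
  split_ifs
  · exact Nat.sub_le _ _
  · change _ ≤ m 0
    dsimp only
    omega

lemma exists_rowIndex_eq (m : Fin 2 → ℕ) (i : Fin 2) : ∃ a, rowIndex m a = (i, m i.rev) := by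
  fin_cases i
  · exact ⟨0, rfl⟩
  · refine ⟨⟨m 1 + 1, by omega⟩, ?_⟩
    rw [rowIndex, if_neg (by simp)]
    exact Prod.ext rfl (by change _ = m 0; dsimp only; omega)

lemma rowIndex_snd_lt {m : Fin 2 → ℕ} {i : Fin 2} {a₀ a : Fin (m 0 + m 1 + 2)}
    (ha₀ : rowIndex m a₀ = (i, m i.rev)) (ha : a ≠ a₀) (hi : (rowIndex m a).1 = i) :
    (rowIndex m a).2 < m i.rev := by
  refine lt_of_le_of_ne (hi ▸ rowIndex_snd_le m a) fun h => ha (rowIndex_injective m ?_)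
  rw [ha₀]
  exact Prod.ext hi h

lemma diffResMatrix_apply {D : Type*} [CommRing D] [Differential D] (m : Fin 2 → ℕ)
    (f : Fin 2 → DiffPoly Unit D) (a b : Fin (m 0 + m 1 + 2)) :
    diffResMatrix (m 0) (m 1) (f 0) (f 1) a b =
      coeff (column (m 0 + m 1) b) (iterDeriv (rowIndex m a).2 (f (rowIndex m a).1)) := by
  unfold diffResMatrix rowIndex column
  rw [Matrix.of_apply]
  split_ifs <;> rfl

variable {K : Type*} [Field K] [Differential K]

/-- `f₀` and `f₁` are linear of orders `m₀` and `m₁`, have the common zero `u`, and their linear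
parts are right coprime linear differential operators. -/
structure IsCoprimeLinearPair (u : K) (m : Fin 2 → ℕ) (f : Fin 2 → DiffPoly Unit K) : Prop where
  totalDegree_le_one : ∀ i, (f i).totalDegree ≤ 1
  ord_eq : ∀ i, ord (f i) = m i
  diffEval_eq_zero : ∀ i, diffEval (fun _ => u) (f i) = 0
  one_mem_leftIdeal : 1 ∈ leftIdeal (Set.range fun i => linearPart (f i))

namespace IsCoprimeLinearPair

variable {u : K} {m : Fin 2 → ℕ} {f : Fin 2 → DiffPoly Unit K}

lemma diffEval_row (h : IsCoprimeLinearPair u m f) (x : Fin 2 × ℕ) :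
    diffEval (fun _ => u) (iterDeriv x.2 (f x.1)) = 0 := by
  obtain ⟨i, k⟩ := x
  dsimp only
  induction k with
  | zero => exact h.diffEval_eq_zero i
  | succ k ih => rw [iterDeriv_succ, diffEval_deriv, ih, map_zero]

lemma row_mem (h : IsCoprimeLinearPair u m f) (a : Fin (m 0 + m 1 + 2)) :
    iterDeriv (rowIndex m a).2 (f (rowIndex m a).1) ∈
      restrictSupport K (affineExponents (m 0 + m 1)) := by
  have hf := mem_restrictSupport_affineExponents (h.totalDegree_le_one (rowIndex m a).1)
    (h.ord_eq (rowIndex m a).1).le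
  refine restrictSupport_affineExponents_mono ?_ (iterDeriv_mem_restrictSupport hf (rowIndex m a).2)
  have hle := rowIndex_snd_le m a
  generalize rowIndex m a = x at hle ⊢
  obtain ⟨i, k⟩ := x
  fin_cases i
  · exact Nat.add_le_add_left hle _
  · exact (Nat.add_le_add_left hle _).trans_eq (add_comm _ _)

lemma linearIndependent_update_row (h : IsCoprimeLinearPair u m f) {i : Fin 2}
    {a₀ : Fin (m 0 + m 1 + 2)} (ha₀ : rowIndex m a₀ = (i, m i.rev)) {q : DiffPoly Unit K}
    (hq : diffEval (fun _ => u) q ≠ 0) :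
    LinearIndependent K (Function.update
      (fun a => iterDeriv (rowIndex m a).2 (f (rowIndex m a).1)) a₀ q) := by
  set g := Function.update (fun a => iterDeriv (rowIndex m a).2 (f (rowIndex m a).1)) a₀ q with hg
  have hrows : ∀ a ∈ ({a₀}ᶜ : Set _), g a = iterDeriv (rowIndex m a).2 (f (rowIndex m a).1) :=
    fun a ha => Function.update_of_ne ha _ _
  have hdegree : (linearPart (f i.rev)).degree = m i.rev := by
    rw [degree_linearPart (h.totalDegree_le_one _), h.ord_eq]
  have hindep : LinearIndepOn K g {a₀}ᶜ := by
    refine LinearIndepOn.of_comp linearPart ?_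
    have hmaps : rowIndex m '' {a₀}ᶜ ⊆ {x | x.1 = i → x.2 < m i.rev} := by
      rintro _ ⟨a, ha, rfl⟩
      exact rowIndex_snd_lt ha₀ ha
    refine (((linearIndepOn_derivComp_iterate hdegree h.one_mem_leftIdeal).mono
      hmaps).comp_of_image (rowIndex_injective m).injOn).congr fun a ha => ?_
    simp only [Function.comp_apply, hrows a ha, linearPart_iterDeriv]
  have hspan : Submodule.span K (g '' {a₀}ᶜ) ≤ LinearMap.ker (diffEval fun _ => u).toLinearMap := by
    rw [Submodule.span_le]
    rintro _ ⟨a, ha, rfl⟩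
    rw [hrows a ha]
    exact h.diffEval_row _
  have hq' : g a₀ ∉ Submodule.span K (g '' {a₀}ᶜ) := fun hmem =>
    hq (by simpa [hg] using hspan hmem)
  rw [← linearIndepOn_univ_iff, ← Set.union_compl_self {a₀}, Set.singleton_union,
    linearIndepOn_insert (by simp)]
  exact ⟨hindep, hq'⟩

lemma det_updateRow_ne_zero (h : IsCoprimeLinearPair u m f) {i : Fin 2}
    {a₀ : Fin (m 0 + m 1 + 2)} (ha₀ : rowIndex m a₀ = (i, m i.rev)) {q : DiffPoly Unit K}
    (hq : diffEval (fun _ => u) q ≠ 0)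
    (hqm : q ∈ restrictSupport K (affineExponents (m 0 + m 1))) :
    ((diffResMatrix (m 0) (m 1) (f 0) (f 1)).updateRow a₀
      fun b => coeff (column (m 0 + m 1) b) q).det ≠ 0 := by
  rw [← isUnit_iff_ne_zero, ← Matrix.isUnit_iff_isUnit_det,
    ← Matrix.linearIndependent_rows_iff_isUnit]
  refine LinearIndependent.of_comp (Fintype.linearCombination K fun b =>
    (monomial (column (m 0 + m 1) b) 1 : DiffPoly Unit K)) ?_
  convert h.linearIndependent_update_row ha₀ hq
  ext1 a
  rw [Function.comp_apply, Fintype.linearCombination_apply]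
  simp only [Matrix.row_apply]
  obtain rfl | ha := eq_or_ne a a₀
  · simp only [Matrix.updateRow_self, Function.update_self, sum_coeff_column_smul_monomial hqm]
  · simp only [Matrix.updateRow_ne ha, Function.update_of_ne ha, diffResMatrix_apply,
      sum_coeff_column_smul_monomial (h.row_mem a)]

lemma det_diffResMatrix (h : IsCoprimeLinearPair u m f) :
    (diffResMatrix (m 0) (m 1) (f 0) (f 1)).det = 0 := by
  rw [← Matrix.exists_mulVec_eq_zero_iff]
  refine ⟨fun b => diffEval (fun _ => u) (monomial (column (m 0 + m 1) b) 1 : DiffPoly Unit K),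
    fun h0 => ?_, ?_⟩
  · have h1 := congrFun h0 (Fin.last (m 0 + m 1 + 1))
    simp [column] at h1
  · ext a
    have hrow := h.diffEval_row (rowIndex m a)
    rw [← sum_coeff_column_smul_monomial (h.row_mem a), map_sum] at hrow
    simpa only [Matrix.mulVec, dotProduct, diffResMatrix_apply, map_smul, smul_eq_mul,
      Pi.zero_apply] using hrow

end IsCoprimeLinearPair

end Matrices

/-! ### Specialization at the parametrization -/

section MapCoefficients

variable {R S : Type*} [CommRing R] [Differential R] [CommRing S] [Differential S] {φ : R →+* S}

lemma map_deriv (hφ : ∀ a, φ (Differential.deriv a) = Differential.deriv (φ a)) {σ : Type*}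
    (f : DiffPoly σ R) : map φ (Differential.deriv f) = Differential.deriv (map φ f) := by
  induction f using induction_on_add_mul with
  | C a => rw [deriv_C, map_C, map_C, deriv_C, hφ]
  | X v => obtain ⟨i, k⟩ := v; rw [deriv_X, map_X, map_X, deriv_X]
  | add f g hf hg => simp only [map_add, hf, hg]
  | mul f g hf hg => simp only [Derivation.leibniz, smul_eq_mul, map_add, map_mul, hf, hg]

lemma map_iterDeriv (hφ : ∀ a, φ (Differential.deriv a) = Differential.deriv (φ a)) {σ : Type*}
    (k : ℕ) (f : DiffPoly σ R) : map φ (iterDeriv k f) = iterDeriv k (map φ f) := by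
  induction k with
  | zero => rfl
  | succ k ih => rw [iterDeriv_succ, map_deriv hφ, ih, iterDeriv_succ]

lemma diffResMatrix_map (hφ : ∀ a, φ (Differential.deriv a) = Differential.deriv (φ a))
    (m₁ m₂ : ℕ) (f₁ f₂ : DiffPoly Unit R) :
    (diffResMatrix m₁ m₂ f₁ f₂).map φ = diffResMatrix m₁ m₂ (map φ f₁) (map φ f₂) := by
  ext a b
  simp only [Matrix.map_apply, diffResMatrix, Matrix.of_apply, ← map_iterDeriv hφ]
  split_ifs <;> simp only [coeff_map]

end MapCoefficients

section ImplicitEqAt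

variable {F D : Type*} [Field F] [CommRing D] [Algebra F D]

/-- The linear differential polynomial `a Q(u) - P(u)` over an extension of `F` that contains `a`.
The implicit equations of a parametrization are those with `a = x` and `a = y`. -/
def implicitEqAt (a : D) (P Q : DiffPoly Unit F) : DiffPoly Unit D :=
  C a * map (algebraMap F D) Q - map (algebraMap F D) P

lemma coeff_implicitEqAt (a : D) (P Q : DiffPoly Unit F) (n : Unit × ℕ →₀ ℕ) :
    coeff n (implicitEqAt a P Q) = a * algebraMap F D (coeff n Q) - algebraMap F D (coeff n P) := by
  rw [implicitEqAt, coeff_sub, coeff_C_mul, coeff_map, coeff_map]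

lemma coeff_implicitEqAt_eq_zero_iff {a : D} (ha : a ∉ Set.range (algebraMap F D))
    {P Q : DiffPoly Unit F} {n : Unit × ℕ →₀ ℕ} :
    coeff n (implicitEqAt a P Q) = 0 ↔ coeff n P = 0 ∧ coeff n Q = 0 := by
  have : Nontrivial D := nontrivial_of_ne a (algebraMap F D 0) fun h => ha ⟨0, h.symm⟩
  rw [coeff_implicitEqAt]
  refine ⟨fun h => ?_, fun ⟨hP, hQ⟩ => by simp [hP, hQ]⟩
  have hQ : coeff n Q = 0 := by
    by_contra hQ
    refine ha ⟨coeff n P / coeff n Q, ?_⟩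
    rw [div_eq_mul_inv, map_mul, ← sub_eq_zero.1 h, mul_assoc, ← map_mul, mul_inv_cancel₀ hQ,
      map_one, mul_one]
  rw [hQ, map_zero, mul_zero, zero_sub, neg_eq_zero] at h
  exact ⟨(map_eq_zero _).1 h, hQ⟩

lemma ord_implicitEqAt {a : D} (ha : a ∉ Set.range (algebraMap F D)) (P Q : DiffPoly Unit F) :
    ord (implicitEqAt a P Q) = ordFrac P Q := by
  classical
  have hvars : (implicitEqAt a P Q).vars = P.vars ∪ Q.vars := by
    ext v
    simp only [mem_vars_iff_mem_support, Finset.mem_union, mem_support_iff, ne_eq,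
      coeff_implicitEqAt_eq_zero_iff ha, not_and_or, or_and_right, exists_or]
  rw [ord, hvars, Finset.sup_union]
  rfl

lemma totalDegree_implicitEqAt_le_one (a : D) {P Q : DiffPoly Unit F} (hP : P.totalDegree ≤ 1)
    (hQ : Q.totalDegree ≤ 1) : (implicitEqAt a P Q).totalDegree ≤ 1 := by
  refine (totalDegree_sub _ _).trans (max_le ((totalDegree_mul _ _).trans ?_) ?_)
  · rw [totalDegree_C, zero_add]
    exact (Finset.sup_mono (support_map_subset _ _)).trans hQ
  · exact (Finset.sup_mono (support_map_subset _ _)).trans hP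

lemma map_implicitEqAt {D' : Type*} [CommRing D'] [Algebra F D'] (φ : D →ₐ[F] D') (a : D)
    (P Q : DiffPoly Unit F) :
    map (φ : D →+* D') (implicitEqAt a P Q) = implicitEqAt (φ a) P Q := by
  simp only [implicitEqAt, map_sub, map_mul, map_C, map_map, AlgHom.comp_algebraMap]
  rfl

lemma linearPart_implicitEqAt (a : D) (P Q : DiffPoly Unit F) :
    linearPart (implicitEqAt a P Q) =
      a • (linearPart Q).map (algebraMap F D) - (linearPart P).map (algebraMap F D) := by
  ext k
  simp [coeff_linearPart, coeff_implicitEqAt]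

end ImplicitEqAt

section LinearFractions

variable {F E : Type*} [Field F] [Field E] [Differential E] [Algebra F E] {u : E}
  {P Q : DiffPoly Unit F}

lemma diffEval_map_algebraMap {σ : Type*} (η : σ → E) (f : DiffPoly σ F) :
    diffEval η (map (algebraMap F E) f) = diffEval η f :=
  aeval_map_algebraMap ..

lemma diffEval_implicitEqAt_div (hQu : diffEval (fun _ => u) Q ≠ 0) :
    diffEval (fun _ => u)
      (implicitEqAt (diffEval (fun _ => u) P / diffEval (fun _ => u) Q) P Q) = 0 := by
  rw [implicitEqAt, map_sub, map_mul, diffEval_C, diffEval_map_algebraMap,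
    diffEval_map_algebraMap, Algebra.algebraMap_self_apply, div_mul_cancel₀ _ hQu, sub_self]

lemma div_notMem_range_algebraMap (hu : DiffTranscendental F u)
    (hQu : diffEval (fun _ => u) Q ≠ 0) (hred : IsRelPrime P Q) (hord : ordFrac P Q ≠ ⊥) :
    diffEval (fun _ => u) P / diffEval (fun _ => u) Q ∉ Set.range (algebraMap F E) := by
  rintro ⟨c, hc⟩
  have hP : P = C c * Q := hu.injective (by
    rw [map_mul, diffEval_C, hc, div_mul_cancel₀ _ hQu])
  have hunit : IsUnit Q := hred ⟨C c, hP.trans (mul_comm _ _)⟩ dvd_rfl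
  obtain ⟨d, -, rfl⟩ := isUnit_iff_eq_C_of_isReduced.1 hunit
  refine hord ?_
  rw [hP, ← C_mul, ordFrac, ord, ord, vars_C, vars_C]
  rfl

lemma gradient_of_totalDegree_le_one (hP : P.totalDegree ≤ 1) :
    gradient u P = (linearPart P).map (algebraMap F E) := by
  rw [gradient, universalDifferential_of_totalDegree_le_one hP, Polynomial.map_map]
  congr 1
  ext c
  exact diffEval_C (fun _ => u) c

lemma hasDifferential_div_of_totalDegree_le_one (hP : P.totalDegree ≤ 1) (hQ : Q.totalDegree ≤ 1)
    (hQu : diffEval (fun _ => u) Q ≠ 0) :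
    HasDifferential F u (diffEval (fun _ => u) P / diffEval (fun _ => u) Q)
      (-(diffEval (fun _ => u) Q)⁻¹ •
        linearPart (implicitEqAt (diffEval (fun _ => u) P / diffEval (fun _ => u) Q) P Q)) := by
  convert HasDifferential.div (p := P) hQu using 1
  rw [linearPart_implicitEqAt, gradient_of_totalDegree_le_one hP,
    gradient_of_totalDegree_le_one hQ]
  module

end LinearFractions

section Properness

variable {F E : Type*} [Field F] [Differential F] [Field E] [Differential E] [Algebra F E]
  [DifferentialAlgebra F E] {u : E}

/-- The operator `1` is the differential of `u`. -/
lemma one_mem_leftIdeal_of_mem_diffAdjoin (hu : DiffTranscendental F u) {S : Set E}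
    {s : Set E[X]} (hS : ∀ a ∈ S, ∃ ω ∈ leftIdeal s, HasDifferential F u a ω)
    (hmem : u ∈ diffAdjoin F S) : 1 ∈ leftIdeal s := by
  obtain ⟨ω, hω, h⟩ :=
    HasDifferential.of_mem_diffAdjoin (fun _ => derivComp_mem_leftIdeal) hS hmem
  rwa [(HasDifferential.self u).unique hu h]

/-- A relation `A(η) = 0` of order less than `m` in `η i` would make some derivative of the
differential of `η i` redundant in the left ideal generated by the differentials, but the first
`m` ones are not. -/
lemma le_of_diffEval_eq_zero (hu : DiffTranscendental F u) {η : Fin 2 → E} {ω : Fin 2 → E[X]}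
    (hη : ∀ j, HasDifferential F u (η j) (ω j)) (h1 : 1 ∈ leftIdeal (Set.range ω))
    {i : Fin 2} {m n : ℕ} (hm : (ω i.rev).degree = m) {A : DiffPoly (Fin 2) F}
    (hA : A ∈ supported F (ordLE i n)) (hAη : diffEval η A = 0)
    (hsep : diffEval η (pderiv (i, n) A) ≠ 0) : m ≤ n := by
  by_contra! hn
  refine iterate_notMem_span hn hm h1 ?_
  set U := Submodule.span E
    ((fun x : Fin 2 × ℕ => derivComp^[x.2] (ω x.1)) '' {x | x.1 = i → x.2 < n})
  obtain ⟨θ, hθ, h⟩ := HasDifferential.diffEval_of_mem_supported (U := U) (v := (i, n))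
    (fun w (hw : w.1 = i → w.2 ≤ n) hwn => ⟨_, Submodule.subset_span ⟨w, fun hwi =>
      lt_of_le_of_ne (hw hwi) fun hw' => hwn (Prod.ext hwi hw'), rfl⟩, (hη w.1).iterDeriv w.2⟩)
    ((hη i).iterDeriv n) hA
  rw [hAη] at h
  have hω : derivComp^[n] (ω i) = (diffEval η (pderiv (i, n) A))⁻¹ • -θ :=
    (eq_inv_smul_iff₀ hsep).2 (eq_neg_of_add_eq_zero_left (h.eq_zero hu))
  rw [hω]
  exact U.smul_mem _ (neg_mem hθ)

end Properness

section Parametrization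

variable {F E : Type*} [Field F] [Differential F] [Field E] [Differential E] [Algebra F E]

/-- The differential of `η = P(u)/Q(u)`, read off from the equation `η Q(u) - P(u) = 0`: the
quotient by `-Q(u)` of the linear part of `η Q - P`. -/
def paramDifferential (u : E) (P Q : Fin 2 → DiffPoly Unit F) (i : Fin 2) : E[X] :=
  -(diffEval (fun _ => u) (Q i))⁻¹ • linearPart (implicitEqAt (paramPoint u P Q i) (P i) (Q i))

namespace IsDiffRatParam

variable {r : Ranking (Fin 2)} {A : DiffPoly (Fin 2) F} {u : E} {P Q : Fin 2 → DiffPoly Unit F}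

lemma diffEval_den_ne_zero (h : IsDiffRatParam r A u P Q) (i : Fin 2) :
    diffEval (fun _ => u) (Q i) ≠ 0 :=
  (map_ne_zero_iff _ h.transcendental.injective).2 (h.den_ne_zero i)

lemma hasDifferential_paramPoint (h : IsDiffRatParam r A u P Q) (hlinear : IsLinearParam P Q)
    (i : Fin 2) : HasDifferential F u (paramPoint u P Q i) (paramDifferential u P Q i) :=
  hasDifferential_div_of_totalDegree_le_one (hlinear i).1 (hlinear i).2 (h.diffEval_den_ne_zero i)

lemma ord_implicitEqAt (h : IsDiffRatParam r A u P Q) {m : Fin 2 → ℕ}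
    (hm : ∀ i, ordFrac (P i) (Q i) = m i) (i : Fin 2) :
    ord (implicitEqAt (paramPoint u P Q i) (P i) (Q i)) = m i := by
  rw [DiffAlg.ord_implicitEqAt, hm]
  exact div_notMem_range_algebraMap h.transcendental (h.diffEval_den_ne_zero i) (h.reduced i)
    (hm i ▸ WithBot.coe_ne_bot)

lemma degree_paramDifferential (h : IsDiffRatParam r A u P Q) (hlinear : IsLinearParam P Q)
    {m : Fin 2 → ℕ} (hm : ∀ i, ordFrac (P i) (Q i) = m i) (i : Fin 2) :
    (paramDifferential u P Q i).degree = m i := by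
  rw [paramDifferential, Polynomial.degree_smul_of_smul_regular, degree_linearPart,
    h.ord_implicitEqAt hm]
  · exact totalDegree_implicitEqAt_le_one _ (hlinear i).1 (hlinear i).2
  · exact .of_ne_zero (neg_ne_zero.2 (inv_ne_zero (h.diffEval_den_ne_zero i)))

variable [DifferentialAlgebra F E]

lemma one_mem_leftIdeal (h : IsDiffRatParam r A u P Q) (hlinear : IsLinearParam P Q)
    (hproper : IsProperParam u P Q) :
    1 ∈ leftIdeal (Set.range (paramDifferential u P Q)) := by
  have hu : u ∈ diffAdjoin F (Set.range (paramPoint u P Q)) := by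
    rw [show diffAdjoin F (Set.range (paramPoint u P Q)) = diffAdjoin F {u} from hproper]
    exact IntermediateField.subset_adjoin _ _ ⟨u, rfl, 0, rfl⟩
  refine one_mem_leftIdeal_of_mem_diffAdjoin h.transcendental ?_ hu
  rintro _ ⟨i, rfl⟩
  exact ⟨_, subset_leftIdeal _ (Set.mem_range_self i), h.hasDifferential_paramPoint hlinear i⟩

lemma isCoprimeLinearPair (h : IsDiffRatParam r A u P Q) (hlinear : IsLinearParam P Q)
    {m : Fin 2 → ℕ} (hm : ∀ i, ordFrac (P i) (Q i) = m i) (hproper : IsProperParam u P Q) :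
    IsCoprimeLinearPair u m fun i => implicitEqAt (paramPoint u P Q i) (P i) (Q i) where
  totalDegree_le_one i := totalDegree_implicitEqAt_le_one _ (hlinear i).1 (hlinear i).2
  ord_eq := h.ord_implicitEqAt hm
  diffEval_eq_zero i := diffEval_implicitEqAt_div (h.diffEval_den_ne_zero i)
  one_mem_leftIdeal := by
    refine leftIdeal_le (fun _ => derivComp_mem_leftIdeal) ?_ (h.one_mem_leftIdeal hlinear hproper)
    rintro _ ⟨i, rfl⟩
    exact Submodule.smul_mem _ _ (subset_leftIdeal _ ⟨i, rfl⟩)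

lemma le_of_isLeader (h : IsDiffRatParam r A u P Q) (hlinear : IsLinearParam P Q)
    {m : Fin 2 → ℕ} (hm : ∀ i, ordFrac (P i) (Q i) = m i) (hproper : IsProperParam u P Q)
    {i : Fin 2} {n : ℕ} (hl : IsLeader r A (i, n)) : m i.rev ≤ n :=
  le_of_diffEval_eq_zero h.transcendental (h.hasDifferential_paramPoint hlinear)
    (h.one_mem_leftIdeal hlinear hproper) (h.degree_paramDifferential hlinear hm i.rev)
    hl.mem_supported_ordLE h.generic.diffEval_eq_zero
    fun h0 => h.generic.diffEval_separantAt_mul_initialAt_ne_zero hl (by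
      rw [map_mul, separantAt, h0, zero_mul])

end IsDiffRatParam

end Parametrization

/-! ### The resultant of the implicit equations -/

section CoefficientsOfRows

lemma deriv_mem_coeffsIn {σ τ R : Type*} [CommRing R] [Differential R] {s t : Set (τ × ℕ)}
    (hst : s ⊆ t) (hst' : ∀ v ∈ s, (v.1, v.2 + 1) ∈ t) {f : DiffPoly σ (DiffPoly τ R)}
    (hf : f ∈ coeffsIn (σ × ℕ) (supported R s).toSubmodule) :
    Differential.deriv f ∈ coeffsIn (σ × ℕ) (supported R t).toSubmodule := by
  rw [f.as_sum, map_sum]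
  refine sum_mem fun n _ => ?_
  have ha : coeff n f ∈ supported R s := hf n
  have hmonomial : monomial n (coeff n f) = C (coeff n f) * map C (monomial n (1 : R)) := by
    rw [map_monomial, map_one, C_mul_monomial, mul_one]
  rw [hmonomial, Derivation.leibniz, deriv_C, ← map_deriv fun a => (deriv_C a).symm]
  intro k
  rw [coeff_add, smul_eq_mul, smul_eq_mul, mul_comm (map C (monomial n (1 : R))), coeff_C_mul,
    coeff_C_mul, coeff_map, coeff_map, Subalgebra.mem_toSubmodule]
  exact add_mem (mul_mem (supported_mono hst ha) (Subalgebra.algebraMap_mem _ _))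
    (mul_mem (deriv_mem_supported hst hst' ha) (Subalgebra.algebraMap_mem _ _))

variable {F : Type*} [Field F] [Differential F]

lemma iterDeriv_implicitEq_sub_mem_coeffsIn (i : Fin 2) (P Q : DiffPoly Unit F) (k : ℕ) :
    iterDeriv k (implicitEq i P Q) - C (X (i, k)) * map C Q ∈
      coeffsIn (Unit × ℕ) (supported F {w : Fin 2 × ℕ | w.1 = i ∧ w.2 < k}).toSubmodule := by
  induction k with
  | zero =>
    intro n
    rw [iterDeriv_zero, implicitEq, sub_sub_cancel_left, coeff_neg, coeff_map]
    exact neg_mem (Subalgebra.algebraMap_mem _ _)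
  | succ k ih =>
    have h := deriv_mem_coeffsIn (t := {w : Fin 2 × ℕ | w.1 = i ∧ w.2 < k + 1})
      (fun w hw => ⟨hw.1, Nat.lt_succ_of_lt hw.2⟩) (fun w hw => ⟨hw.1, Nat.succ_lt_succ hw.2⟩) ih
    have hX : C (X (i, k)) * map C (Differential.deriv Q) ∈ coeffsIn (Unit × ℕ)
        (supported F {w : Fin 2 × ℕ | w.1 = i ∧ w.2 < k + 1}).toSubmodule := by
      intro n
      rw [coeff_C_mul, coeff_map, Subalgebra.mem_toSubmodule]
      exact mul_mem (X_mem_supported.2 ⟨rfl, k.lt_succ_self⟩) (Subalgebra.algebraMap_mem _ _)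
    rw [map_sub, Derivation.leibniz, deriv_C, deriv_X, ← map_deriv fun a => (deriv_C a).symm,
      smul_eq_mul, smul_eq_mul] at h
    rw [iterDeriv_succ]
    convert add_mem h hX using 1
    ring

lemma coeff_iterDeriv_implicitEq_sub_mem_supported (i : Fin 2) (P Q : DiffPoly Unit F) (k : ℕ)
    (n : Unit × ℕ →₀ ℕ) :
    coeff n (iterDeriv k (implicitEq i P Q)) - X (i, k) * C (coeff n Q) ∈
      supported F {w : Fin 2 × ℕ | w.1 = i ∧ w.2 < k} := by
  simpa only [coeff_sub, coeff_C_mul, coeff_map, Subalgebra.mem_toSubmodule] using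
    iterDeriv_implicitEq_sub_mem_coeffsIn i P Q k n

lemma coeff_iterDeriv_implicitEq_mem_supported (i : Fin 2) (P Q : DiffPoly Unit F) (k : ℕ)
    (n : Unit × ℕ →₀ ℕ) :
    coeff n (iterDeriv k (implicitEq i P Q)) ∈
      supported F {w : Fin 2 × ℕ | w.1 = i ∧ w.2 ≤ k} := by
  have hsub : {w : Fin 2 × ℕ | w.1 = i ∧ w.2 < k} ⊆ {w | w.1 = i ∧ w.2 ≤ k} :=
    fun _ hw => ⟨hw.1, hw.2.le⟩
  have hX : (X (i, k) : DiffPoly (Fin 2) F) ∈ supported F {w : Fin 2 × ℕ | w.1 = i ∧ w.2 ≤ k} :=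
    X_mem_supported.2 ⟨rfl, le_rfl⟩
  have hC : (C (coeff n Q) : DiffPoly (Fin 2) F) ∈
      supported F {w : Fin 2 × ℕ | w.1 = i ∧ w.2 ≤ k} := Subalgebra.algebraMap_mem _ _
  rw [← sub_add_cancel (coeff n (iterDeriv k (implicitEq i P Q))) (X (i, k) * C (coeff n Q))]
  exact add_mem (supported_mono hsub (coeff_iterDeriv_implicitEq_sub_mem_supported i P Q k n))
    (mul_mem hX hC)

end CoefficientsOfRows

section LinearInOneVariable

variable {ι R τ : Type*} [CommRing R]

lemma det_mem_of_forall_mem [Fintype ι] [DecidableEq ι] {D : Type*} [CommRing D] [Algebra R D]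
    {S : Subalgebra R D} {M : Matrix ι ι D} (h : ∀ a b, M a b ∈ S) : M.det ∈ S := by
  rw [Matrix.det_apply]
  refine sum_mem fun g _ => ?_
  rw [Units.smul_def]
  exact zsmul_mem (prod_mem fun a _ => h _ _) _

lemma det_updateRow_mem_of_forall_mem [Fintype ι] [DecidableEq ι] {D : Type*} [CommRing D]
    [Algebra R D] {S : Subalgebra R D} {M : Matrix ι ι D} {a₀ : ι} {c : ι → D}
    (hc : ∀ b, c b ∈ S) (h : ∀ a, a ≠ a₀ → ∀ b, M a b ∈ S) : (M.updateRow a₀ c).det ∈ S := by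
  refine det_mem_of_forall_mem fun a b => ?_
  obtain rfl | ha := eq_or_ne a a₀
  · rw [Matrix.updateRow_self]
    exact hc b
  · rw [Matrix.updateRow_ne ha]
    exact h a ha b

lemma det_sub_X_mul_mem_supported [Fintype ι] [DecidableEq ι] {s : Set τ}
    {M : Matrix ι ι (MvPolynomial τ R)} {a₀ : ι} {v : τ} {c : ι → MvPolynomial τ R}
    (h₀ : ∀ b, M a₀ b - X v * c b ∈ supported R s)
    (h : ∀ a, a ≠ a₀ → ∀ b, M a b ∈ supported R s) :
    M.det - X v * (M.updateRow a₀ c).det ∈ supported R s := by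
  have hrow : (M a₀ - (X v : MvPolynomial τ R) • c) + (X v : MvPolynomial τ R) • c = M a₀ :=
    sub_add_cancel _ _
  have hdet : M.det = (M.updateRow a₀ (M a₀ - (X v : MvPolynomial τ R) • c)).det +
      X v * (M.updateRow a₀ c).det := by
    rw [← Matrix.det_updateRow_smul, ← Matrix.det_updateRow_add, hrow, Matrix.updateRow_eq_self]
  rw [hdet, add_sub_cancel_right]
  exact det_updateRow_mem_of_forall_mem h₀ h

lemma degreeOf_eq_zero_of_mem_supported {s : Set τ} {v : τ} (hv : v ∉ s) {f : MvPolynomial τ R}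
    (hf : f ∈ supported R s) : f.degreeOf v = 0 := by
  by_contra h
  exact hv (mem_supported.1 hf (mem_vars_iff_degreeOf_ne_zero.2 h))

lemma degreeOf_le_one_of_sub_X_mul_mem_supported [Nontrivial R] {s : Set τ} {v : τ} (hv : v ∉ s)
    {f g : MvPolynomial τ R} (hg : g ∈ supported R s) (hf : f - X v * g ∈ supported R s) :
    f.degreeOf v ≤ 1 := by
  rw [← sub_add_cancel f (X v * g)]
  refine (degreeOf_add_le _ _ _).trans (max_le ?_ ((degreeOf_mul_le _ _ _).trans ?_))
  · rw [degreeOf_eq_zero_of_mem_supported hv hf]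
    exact zero_le_one
  · rw [degreeOf_eq_zero_of_mem_supported hv hg, degreeOf_X_self]

lemma pderiv_eq_of_sub_X_mul_mem_supported {s : Set τ} {v : τ} (hv : v ∉ s)
    {f g : MvPolynomial τ R} (hg : g ∈ supported R s) (hf : f - X v * g ∈ supported R s) :
    pderiv v f = g := by
  have h := pderiv_eq_zero_of_mem_supported hv hf
  rw [map_sub, Derivation.leibniz, pderiv_eq_zero_of_mem_supported hv hg, pderiv_X_self,
    smul_zero, zero_add, smul_eq_mul, mul_one, sub_eq_zero] at h
  exact h

lemma degreeOf_eq_of_map_pderiv_mul_ne_zero [IsDomain R] {S : Type*} [CommRing S] {v : τ}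
    {f g : MvPolynomial τ R} (hdeg : (f * g).degreeOf v ≤ 1) {φ : MvPolynomial τ R →+* S}
    (hf : φ f = 0) (hfg : φ (pderiv v (f * g)) ≠ 0) : f.degreeOf v = 1 ∧ g.degreeOf v = 0 := by
  have hf0 : f ≠ 0 := by rintro rfl; simp at hfg
  have hg0 : g ≠ 0 := by rintro rfl; simp at hfg
  rw [Derivation.leibniz, map_add, smul_eq_mul, smul_eq_mul, map_mul, map_mul, hf, zero_mul,
    zero_add] at hfg
  have hdeg_f : f.degreeOf v ≠ 0 := by
    rw [← mem_vars_iff_degreeOf_ne_zero]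
    by_contra hv
    rw [pderiv_eq_zero_of_notMem_vars hv, map_zero, mul_zero] at hfg
    exact hfg rfl
  rw [degreeOf_mul_eq hf0 hg0] at hdeg
  omega

end LinearInOneVariable

lemma ord_lt_ord_mul {σ R : Type*} [CommRing R] [IsDomain R] [Nonempty σ] {d : σ → ℕ}
    {f g : DiffPoly σ R} (hfg : f * g ≠ 0) (hsupp : f * g ∈ supported R {w | w.2 ≤ d w.1})
    (hf : ∀ j, f.degreeOf (j, d j) ≠ 0) (hg : ∀ j, g.degreeOf (j, d j) = 0) :
    ord g < ord (f * g) := by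
  have hdeg : ∀ w, (f * g).degreeOf w = f.degreeOf w + g.degreeOf w := fun w =>
    degreeOf_mul_eq (left_ne_zero_of_mul hfg) (right_ne_zero_of_mul hfg)
  have hle : ∀ j, (d j : WithBot ℕ) ≤ ord (f * g) := fun j =>
    Finset.le_sup (f := fun w : σ × ℕ => (w.2 : WithBot ℕ)) (b := (j, d j)) (by
      rw [mem_vars_iff_degreeOf_ne_zero, hdeg]
      exact ne_of_gt (Nat.add_pos_left (Nat.pos_of_ne_zero (hf j)) _))
  have hbot : ⊥ < ord (f * g) := (WithBot.bot_lt_coe _).trans_le (hle (Classical.arbitrary σ))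
  refine (Finset.sup_lt_iff hbot).2 fun ⟨j, k⟩ hjk => ?_
  have hjk' : g.degreeOf (j, k) ≠ 0 := mem_vars_iff_degreeOf_ne_zero.1 hjk
  have hk : k ≤ d j := mem_supported.1 hsupp (show (j, k) ∈ (f * g).vars by
    rw [mem_vars_iff_degreeOf_ne_zero, hdeg]
    omega)
  have hne : k ≠ d j := by
    rintro rfl
    exact hjk' (hg j)
  exact lt_of_lt_of_le (by exact_mod_cast lt_of_le_of_ne hk hne) (hle j)

section ImplicitResultant

lemma X_notMem_range_algebraMap {τ R : Type*} [CommRing R] [Nontrivial R] (v : τ) :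
    (X v : MvPolynomial τ R) ∉ Set.range (algebraMap R (MvPolynomial τ R)) := by
  rintro ⟨c, hc⟩
  simpa using congrArg totalDegree hc

variable {F : Type*} [Field F]

lemma ord_implicitEq (i : Fin 2) (P Q : DiffPoly Unit F) :
    ord (implicitEq i P Q) = ordFrac P Q :=
  ord_implicitEqAt (X_notMem_range_algebraMap _) P Q

variable [Differential F]

/-- The differential resultant matrix of `x Q₁(u) - P₁(u)` and `y Q₂(u) - P₂(u)`, when `m₁` and
`m₂` are the orders of the two fractions. -/
def implicitMatrix (m : Fin 2 → ℕ) (P Q : Fin 2 → DiffPoly Unit F) :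
    Matrix (Fin (m 0 + m 1 + 2)) (Fin (m 0 + m 1 + 2)) (DiffPoly (Fin 2) F) :=
  diffResMatrix (m 0) (m 1) (implicitEq 0 (P 0) (Q 0)) (implicitEq 1 (P 1) (Q 1))

variable {P Q : Fin 2 → DiffPoly Unit F} {m : Fin 2 → ℕ}

lemma diffRes_implicitEq (hm : ∀ i, ordFrac (P i) (Q i) = m i) :
    diffRes (implicitEq 0 (P 0) (Q 0)) (implicitEq 1 (P 1) (Q 1)) = (implicitMatrix m P Q).det := by
  rw [diffRes, ord_implicitEq, ord_implicitEq, hm, hm]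
  rfl

lemma implicitMatrix_apply (a b : Fin (m 0 + m 1 + 2)) :
    implicitMatrix m P Q a b = coeff (column (m 0 + m 1) b) (iterDeriv (rowIndex m a).2
      (implicitEq (rowIndex m a).1 (P (rowIndex m a).1) (Q (rowIndex m a).1))) :=
  diffResMatrix_apply m (fun i => implicitEq i (P i) (Q i)) a b

lemma det_implicitMatrix_mem_supported :
    (implicitMatrix m P Q).det ∈ supported F {w | w.2 ≤ m w.1.rev} := by
  refine det_mem_of_forall_mem fun a b => ?_
  rw [implicitMatrix_apply]
  refine supported_mono ?_ (coeff_iterDeriv_implicitEq_mem_supported _ _ _ _ _)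
  rintro w ⟨hw, hk⟩
  exact hk.trans (hw ▸ rowIndex_snd_le m a)

/-- The row that carries the highest derivative of the `i`-th coordinate is linear in it, and the
other rows are free of it. -/
lemma exists_pderiv_det_implicitMatrix (m : Fin 2 → ℕ) (P Q : Fin 2 → DiffPoly Unit F)
    (i : Fin 2) : ∃ a₀, rowIndex m a₀ = (i, m i.rev) ∧
      (implicitMatrix m P Q).det.degreeOf (i, m i.rev) ≤ 1 ∧
      pderiv (i, m i.rev) (implicitMatrix m P Q).det = ((implicitMatrix m P Q).updateRow a₀
        fun b => C (coeff (column (m 0 + m 1) b) (Q i))).det := by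
  obtain ⟨a₀, ha₀⟩ := exists_rowIndex_eq m i
  set s : Set (Fin 2 × ℕ) := {w | w.2 ≤ m w.1.rev ∧ w ≠ (i, m i.rev)}
  have hv : (i, m i.rev) ∉ s := fun h => h.2 rfl
  have hrow : ∀ b, implicitMatrix m P Q a₀ b -
      X (i, m i.rev) * C (coeff (column (m 0 + m 1) b) (Q i)) ∈ supported F s := by
    intro b
    rw [implicitMatrix_apply, ha₀]
    refine supported_mono ?_ (coeff_iterDeriv_implicitEq_sub_mem_supported _ _ _ _ _)
    rintro w ⟨rfl, hw⟩
    exact ⟨hw.le, fun h => hw.ne (congrArg Prod.snd h)⟩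
  have hrows : ∀ a, a ≠ a₀ → ∀ b, implicitMatrix m P Q a b ∈ supported F s := by
    intro a ha b
    rw [implicitMatrix_apply]
    refine supported_mono ?_ (coeff_iterDeriv_implicitEq_mem_supported _ _ _ _ _)
    rintro w ⟨hw, hk⟩
    refine ⟨hk.trans (hw ▸ rowIndex_snd_le m a), ?_⟩
    rintro rfl
    exact (hk.trans_lt (rowIndex_snd_lt ha₀ ha hw.symm)).false
  have hdet := det_sub_X_mul_mem_supported hrow hrows
  have hcofactor := det_updateRow_mem_of_forall_mem
    (fun b => Subalgebra.algebraMap_mem _ (coeff (column (m 0 + m 1) b) (Q i))) hrows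
  exact ⟨a₀, ha₀, degreeOf_le_one_of_sub_X_mul_mem_supported hv hcofactor hdet,
    pderiv_eq_of_sub_X_mul_mem_supported hv hcofactor hdet⟩

variable {E : Type*} [Field E] [Differential E] [Algebra F E] [DifferentialAlgebra F E]

lemma implicitMatrix_map_diffEval (m : Fin 2 → ℕ) (u : E) (P Q : Fin 2 → DiffPoly Unit F) :
    (implicitMatrix m P Q).map (diffEval (paramPoint u P Q)) = diffResMatrix (m 0) (m 1)
      (implicitEqAt (paramPoint u P Q 0) (P 0) (Q 0))
      (implicitEqAt (paramPoint u P Q 1) (P 1) (Q 1)) := by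
  refine (diffResMatrix_map (φ := (diffEval (paramPoint u P Q) : _ →ₐ[F] E).toRingHom)
    (diffEval_deriv _) _ _ _ _).trans ?_
  have hmap : ∀ i, map (diffEval (paramPoint u P Q) : _ →ₐ[F] E).toRingHom
      (implicitEq i (P i) (Q i)) = implicitEqAt (paramPoint u P Q i) (P i) (Q i) := fun i => by
    refine (map_implicitEqAt (diffEval (paramPoint u P Q)) (X (i, 0)) (P i) (Q i)).trans ?_
    rw [diffEval_X]
    rfl
  rw [hmap, hmap]

end ImplicitResultant

namespace IsDiffRatParam

variable {F E : Type*} [Field F] [Differential F] [Field E] [Differential E] [Algebra F E]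
  [DifferentialAlgebra F E] {r : Ranking (Fin 2)} {A : DiffPoly (Fin 2) F} {u : E}
  {P Q : Fin 2 → DiffPoly Unit F} {m : Fin 2 → ℕ}

lemma diffEval_det_implicitMatrix (h : IsDiffRatParam r A u P Q) (hlinear : IsLinearParam P Q)
    (hm : ∀ i, ordFrac (P i) (Q i) = m i) (hproper : IsProperParam u P Q) :
    diffEval (paramPoint u P Q) (implicitMatrix m P Q).det = 0 := by
  rw [AlgHom.map_det, AlgHom.mapMatrix_apply, implicitMatrix_map_diffEval]
  exact (h.isCoprimeLinearPair hlinear hm hproper).det_diffResMatrix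

lemma diffEval_pderiv_det_implicitMatrix_ne_zero (h : IsDiffRatParam r A u P Q)
    (hlinear : IsLinearParam P Q) (hm : ∀ i, ordFrac (P i) (Q i) = m i)
    (hproper : IsProperParam u P Q) (i : Fin 2) :
    diffEval (paramPoint u P Q) (pderiv (i, m i.rev) (implicitMatrix m P Q).det) ≠ 0 := by
  obtain ⟨a₀, ha₀, -, hpderiv⟩ := exists_pderiv_det_implicitMatrix m P Q i
  have hrow : (⇑(diffEval (paramPoint u P Q)) ∘
      fun b => C (coeff (column (m 0 + m 1) b) (Q i))) =
      fun b => coeff (column (m 0 + m 1) b) (map (algebraMap F E) (Q i)) := by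
    ext b
    rw [Function.comp_apply, diffEval_C, coeff_map]
  rw [hpderiv, AlgHom.map_det, AlgHom.mapMatrix_apply, Matrix.map_updateRow,
    implicitMatrix_map_diffEval, hrow]
  refine (h.isCoprimeLinearPair hlinear hm hproper).det_updateRow_ne_zero ha₀ ?_ ?_
  · rw [diffEval_map_algebraMap]
    exact h.diffEval_den_ne_zero i
  · refine mem_restrictSupport_affineExponents
      ((Finset.sup_mono (support_map_subset _ _)).trans (hlinear i).2) ?_
    have hord : ord (Q i) ≤ m i := (le_max_right _ _).trans (hm i).le
    have hmi : m i ≤ m 0 + m 1 := by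
      fin_cases i
      exacts [Nat.le_add_right _ _, Nat.le_add_left _ _]
    exact (Finset.sup_mono (vars_map _ _)).trans (hord.trans (by exact_mod_cast hmi))

lemma degreeOf_eq_of_det_implicitMatrix_eq_mul (h : IsDiffRatParam r A u P Q)
    (hlinear : IsLinearParam P Q) (hm : ∀ i, ordFrac (P i) (Q i) = m i)
    (hproper : IsProperParam u P Q) {B : DiffPoly (Fin 2) F}
    (hB : (implicitMatrix m P Q).det = A * B) (i : Fin 2) :
    A.degreeOf (i, m i.rev) = 1 ∧ B.degreeOf (i, m i.rev) = 0 := by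
  obtain ⟨-, -, hdeg, -⟩ := exists_pderiv_det_implicitMatrix m P Q i
  have hpderiv := h.diffEval_pderiv_det_implicitMatrix_ne_zero hlinear hm hproper i
  rw [hB] at hdeg hpderiv
  exact degreeOf_eq_of_map_pderiv_mul_ne_zero hdeg
    (φ := (diffEval (paramPoint u P Q) : _ →ₐ[F] E).toRingHom) h.generic.diffEval_eq_zero hpderiv

lemma dvd_det_implicitMatrix (h : IsDiffRatParam r A u P Q) (hlinear : IsLinearParam P Q)
    (hm : ∀ i, ordFrac (P i) (Q i) = m i) (hproper : IsProperParam u P Q) :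
    A ∣ (implicitMatrix m P Q).det := by
  obtain ⟨⟨i, n⟩, hl⟩ := h.generic.exists_isLeader
  refine h.generic.dvd_of_diffEval_eq_zero h.irreducible hl
    (h.diffEval_det_implicitMatrix hlinear hm hproper)
    (supported_mono ?_ det_implicitMatrix_mem_supported)
  rintro w hw rfl
  exact le_trans hw (h.le_of_isLeader hlinear hm hproper hl)

lemma ord_lt_of_det_implicitMatrix_eq_mul (h : IsDiffRatParam r A u P Q)
    (hlinear : IsLinearParam P Q) (hm : ∀ i, ordFrac (P i) (Q i) = m i)
    (hproper : IsProperParam u P Q) {B : DiffPoly (Fin 2) F}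
    (hB : (implicitMatrix m P Q).det = A * B) : ord B < ord (implicitMatrix m P Q).det := by
  have hdegree := h.degreeOf_eq_of_det_implicitMatrix_eq_mul hlinear hm hproper hB
  have hne : A * B ≠ 0 := fun h0 =>
    h.diffEval_pderiv_det_implicitMatrix_ne_zero hlinear hm hproper 0 (by simp [hB, h0])
  rw [hB]
  exact ord_lt_ord_mul (d := fun j => m j.rev) hne (hB ▸ det_implicitMatrix_mem_supported)
    (fun j => by simp [(hdegree j).1]) fun j => (hdegree j).2

end IsDiffRatParam
end DiffAlg

end

open DiffAlg in
theorem mainTheorem9_general {F E : Type*} [Field F] [Differential F]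
    [Field E] [Differential E] [Algebra F E] [DifferentialAlgebra F E]
    (r : Ranking (Fin 2)) (A : DiffPoly (Fin 2) F) (u : E)
    (P Q : Fin 2 → DiffPoly Unit F) (m₁ m₂ : ℕ)
    (hparam : IsDiffRatParam r A u P Q) (hlinear : IsLinearParam P Q)
    (hm₁ : ordFrac (P 0) (Q 0) = m₁) (hm₂ : ordFrac (P 1) (Q 1) = m₂)
    (hproper : IsProperParam u P Q) :
    IsMainIrreducibleFactor A
        (diffRes (implicitEq 0 (P 0) (Q 0)) (implicitEq 1 (P 1) (Q 1))) ∧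
      A.degreeOf (0, m₂) = 1 ∧ A.degreeOf (1, m₁) = 1 := by
  have hm : ∀ i, ordFrac (P i) (Q i) = (![m₁, m₂] i : ℕ) := Fin.forall_fin_two.2 ⟨hm₁, hm₂⟩
  have hdvd := hparam.dvd_det_implicitMatrix hlinear hm hproper
  have ⟨B, hB⟩ := hdvd
  have hdegree := fun i =>
    (hparam.degreeOf_eq_of_det_implicitMatrix_eq_mul hlinear hm hproper hB i).1
  rw [diffRes_implicitEq hm]
  exact ⟨⟨hparam.irreducible, hdvd, fun _ =>
    hparam.ord_lt_of_det_implicitMatrix_eq_mul hlinear hm hproper⟩, hdegree 0, hdegree 1⟩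

theorem mainTheorem9 {F E : Type*} [Field F] [CharZero F] [Differential F]
    [Field E] [Differential E] [Algebra F E] [DifferentialAlgebra F E]
    (r : DiffAlg.Ranking (Fin 2)) (A : DiffAlg.DiffPoly (Fin 2) F) (u : E)
    (P Q : Fin 2 → DiffAlg.DiffPoly Unit F) (m₁ m₂ : ℕ)
    (hparam : DiffAlg.IsDiffRatParam r A u P Q)
    (hlinear : DiffAlg.IsLinearParam P Q)
    (hm₁ : DiffAlg.ordFrac (P 0) (Q 0) = m₁)
    (hm₂ : DiffAlg.ordFrac (P 1) (Q 1) = m₂)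
    (hproper : DiffAlg.IsProperParam u P Q) :
    DiffAlg.IsMainIrreducibleFactor A
        (DiffAlg.diffRes (DiffAlg.implicitEq 0 (P 0) (Q 0))
          (DiffAlg.implicitEq 1 (P 1) (Q 1))) ∧
      A.degreeOf (0, m₂) = 1 ∧ A.degreeOf (1, m₁) = 1 :=
  mainTheorem9_general r A u P Q m₁ m₂ hparam hlinear hm₁ hm₂ hproper
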